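/- **Setting.** Let $I\subset\mathbb R$ be an interval of length $1$, $m$ Lebesgue measure on $I$, $|E|=m(E)$, and $|\cdot|_r$ the norm of $L^r(m)$. Let $\mathcal P=(\mathcal P^k)_{k\ge 0}$ be a $(c_1,c_2)$-good grid of $I$, $0<c_1<c_2<1$, consisting of intervals. That is, the $\mathcal P^k$ are finite families of intervals of positive measure, no set occurring in two different levels, such that: $\mathcal P^0=\{I\}$; each $\mathcal P^k$ is pairwise disjoint and covers $I$ up to a null set; each $Q\in\mathcal P^{k+1}$ is contained in some $R\in\mathcal P^{k}$; $c_1\le |Q|/|R|\le c_2$ whenever $Q\subset R$, $Q\in\mathcal P^{k+1}$, $R\in\mathcal P^k$; and $\bigcup_k\mathcal P^k$ generates the $\sigma$-algebra of $I$ up to null sets. Write $Q\in\mathcal P$ for $Q\in\bigcup_k\mathcal P^k$, and let $M=\sup_k\sup_{Q\in\mathcal P^k}\#\{R\in\mathcal P^k: R\cap Q\ne\emptyset\}$. Let $1\le p<\infty$. **Spaces.** For $q\in[1,\infty]$ and a family $\mathcal A=(\mathcal A(Q))_{Q\in\mathcal P}$ of sets of complex functions, $\mathcal B^s_{p,q}(\mathcal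 A)=\mathcal B^s_{p,q}(I,\mathcal P,\mathcal A)$ is the set of all $g\in L^p(m)$ of the form $g=\sum_{k}\sum_{Q\in\mathcal P^k}s_Qa_Q$ with $a_Q\in\mathcal A(Q)$, $s_Q\in\mathbb C$, where the series over $k$ converges absolutely in $L^p$ and the cost $\big(\sum_k(\sum_{Q\in\mathcal P^k}|s_Q|^p)^{q/p}\big)^{1/q}$ is finite (supremum over $k$ if $q=\infty$); $|g|_{\mathcal B^s_{p,q}(\mathcal A)}$ is the infimum of the costs of all such representations. For $Q\in\mathcal P^{k_0}$, the spaces $\mathcal B^{\beta}_{p,q}(Q,\mathcal P_Q,\mathcal A)$ are defined in the same way with $I$ replaced by $Q$ and $\mathcal P$ by the induced grid $\mathcal P_Q^i=\{R\in\mathcal P^{k_0+i}:R\subset Q\}$. **Atoms.** Let $Q\in\mathcal P$ and $0<s\le\beta$. * $\mathcal A^{sz}_{s,p}(Q)$ (Souza atoms): functions $a$ that vanish outside $Q$ and are constant on $Q$, with $|a|_\infty\le|Q|^{s-1/p}$. Put $\mathcal B^s_{p,q}=\mathcal B^s_{p,q}(\mathcal A^{sz}_{s,p})$. * $\mathcal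 A^{bv}_{s,\beta,p}(Q)$ (bounded variation atoms): functions $a$ that vanish outside $Q$ with $|a|_\infty\le|Q|^{s-1/p}$ and $\sup\big(\sum_i|a(x_{i+1})-a(x_i)|^{1/\beta}\big)^{\beta}\le|Q|^{s-1/p}$, the supremum being over all finite sequences $x_0<x_1<\dots<x_n$ in the interior of $Q$. * $\mathcal A^{bs}_{s,\beta,p,q}(Q)$ (Besov atoms): functions $a\in\mathcal B^\beta_{p,q}(Q,\mathcal P_Q,\mathcal A^{sz}_{\beta,p})$ that vanish outside $Q$, with $|a|_{\mathcal B^\beta_{p,q}(Q,\mathcal P_Q,\mathcal A^{sz}_{\beta,p})}\le K_q^{-1}|Q|^{s-\beta}$, where $K_q=M^{1+1/p}\big(\sum_{k\ge0}c_2^{k\beta q}\big)^{1/q}$ (and $K_\infty=M^{1+1/p}\sup_k c_2^{k\beta}$). **Proposition.** 1. If $0<s\le\beta\le 1/p$, there is $C>0$ such that $C\,\mathcal A^{bv}_{s,\beta,p}(Q)\subset\mathcal A^{bs}_{s,\beta,p,\infty}(Q)$ for every $Q\in\mathcal P$. 2. If $0<s\le\beta<\tilde\beta\le 1/p$, there is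 $C>0$ such that $C\,\mathcal A^{bv}_{s,\tilde\beta,p}(Q)\subset\mathcal A^{bs}_{s,\beta,p,q}(Q)$ for every $Q\in\mathcal P$ and every $q\in[1,\infty]$. 3. If $0<s<\beta\le 1/p$ and $q\in[1,\infty]$, then $\mathcal B^s_{p,q}=\mathcal B^s_{p,q}(\mathcal A^{bv}_{s,\beta,p})$, and the two norms are equivalent. (In particular, if $0<s\le\beta<\tilde\beta\le1/p$, then $\mathcal B^s_{p,q}=\mathcal B^s_{p,q}(\mathcal A^{bv}_{s,\tilde\beta,p})$ with equivalent norms, and both also agree with $\mathcal B^s_{p,q}(\mathcal A^{bv}_{s,\beta,p})$ when $s<\beta$.) -/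

import Mathlib

open MeasureTheory Filter Topology
open scoped ENNReal

noncomputable section

namespace BesovGrid

variable {Ω : Type*} [MeasurableSpace Ω]

/-- The largest number of elements of one level that meet a given element of that level. -/
def gridMult (P : ℕ → Finset (Set Ω)) : ℝ≥0∞ :=
  open Classical in
  ⨆ k, ⨆ Q ∈ P k, (((P k).filter (fun R => (R ∩ Q).Nonempty)).card : ℝ≥0∞)

/-- A grid on `(Ω, m)`: a sequence of finite families of measurable sets of positive measure,
not all empty, with bounded overlap inside each level and no set occurring in two levels. -/
structure IsGrid (m : Measure Ω) (P : ℕ → Finset (Set Ω)) : Prop where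
  measurable : ∀ k, ∀ Q ∈ P k, MeasurableSet Q
  pos : ∀ k, ∀ Q ∈ P k, 0 < m Q
  nonempty : ∃ k, (P k).Nonempty
  mult : gridMult P < ∞
  ne : ∀ i j, i ≠ j → ∀ Q ∈ P i, ∀ R ∈ P j, Q ≠ R

/-- A `(c₁, c₂)`-good grid of the phase space `I`, where `m` is a measure carried by `I`.
The last field says that the grid generates the `σ`-algebra, up to sets of measure zero (the
union in `cover` is also only required to be `I` up to a set of measure zero). -/
structure IsGoodGrid (m : Measure Ω) (I : Set Ω) (P : ℕ → Finset (Set Ω)) (c₁ c₂ : ℝ) : Prop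
    extends IsGrid m P where
  c₁_pos : 0 < c₁
  c₁_lt : c₁ < c₂
  c₂_lt : c₂ < 1
  zero : P 0 = {I}
  cover : ∀ k, m (I \ ⋃ Q ∈ P k, Q) = 0
  disjoint : ∀ k, ∀ Q ∈ P k, ∀ R ∈ P k, Q ≠ R → Disjoint Q R
  nested : ∀ k, ∀ Q ∈ P (k + 1), ∃ R ∈ P k, Q ⊆ R
  ratio : ∀ k, ∀ R ∈ P k, ∀ Q ∈ P (k + 1), Q ⊆ R →
    c₁ ≤ m.real Q / m.real R ∧ m.real Q / m.real R ≤ c₂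
  generate : ∀ E, MeasurableSet E →
    ∃ F, MeasurableSet[MeasurableSpace.generateFrom (⋃ k, (P k : Set (Set Ω)))] F ∧ E =ᵐ[m] F

/-- The cost `(∑ₖ (∑_{Q ∈ Pᵏ} |c_Q|ᵖ)^{q/p})^{1/q}`, with a supremum over `k` if `q = ∞`. -/
def cost (p : ℝ) (q : ℝ≥0∞) (P : ℕ → Finset (Set Ω)) (c : Set Ω → ℂ) : ℝ≥0∞ :=
  open Classical in
  if q = ∞ then ⨆ k, (∑ Q ∈ P k, ‖c Q‖ₑ ^ p) ^ (1 / p)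
  else (∑' k, (∑ Q ∈ P k, ‖c Q‖ₑ ^ p) ^ (q.toReal / p)) ^ (1 / q.toReal)

/-- `g = ∑ₖ ∑_{Q ∈ Pᵏ} c_Q a_Q` is a representation of `g` by atoms `a_Q ∈ A Q`: the cost is
finite and the series of the level sums converges absolutely in `Lᵖ(m)`, with sum `g`. -/
structure IsRepresentation (m : Measure Ω) (P : ℕ → Finset (Set Ω))
    (A : Set Ω → Set (Ω → ℂ)) (p : ℝ) (q : ℝ≥0∞) (g : Ω → ℂ)
    (c : Set Ω → ℂ) (a : Set Ω → Ω → ℂ) : Prop where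
  atom : ∀ k, ∀ Q ∈ P k, a Q ∈ A Q
  cost_lt : cost p q P c < ∞
  abs_conv : ∑' k, (eLpNorm (fun x => ∑ Q ∈ P k, c Q * a Q x) (ENNReal.ofReal p) m) ^
    (p / max p 1) < ∞
  tendsto : Tendsto (fun N => eLpNorm
      (fun x => g x - ∑ k ∈ Finset.range N, ∑ Q ∈ P k, c Q * a Q x) (ENNReal.ofReal p) m)
    atTop (𝓝 0)

/-- The Besov-ish space of the functions in `Lᵖ(m)` that have a representation. It is a set of
functions that is invariant under almost everywhere equality. -/
def besovSpace (m : Measure Ω) (P : ℕ → Finset (Set Ω)) (A : Set Ω → Set (Ω → ℂ))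
    (p : ℝ) (q : ℝ≥0∞) : Set (Ω → ℂ) :=
  {g | MemLp g (ENNReal.ofReal p) m ∧ ∃ c a, IsRepresentation m P A p q g c a}

/-- The norm of the Besov-ish space: the infimum of the costs of all representations. -/
def besovNorm (m : Measure Ω) (P : ℕ → Finset (Set Ω)) (A : Set Ω → Set (Ω → ℂ))
    (p : ℝ) (q : ℝ≥0∞) (g : Ω → ℂ) : ℝ≥0∞ :=
  ⨅ (c : Set Ω → ℂ) (a : Set Ω → Ω → ℂ) (_ : IsRepresentation m P A p q g c a), cost p q P c

/-- The `(s, p)`-Souza atoms on `Q`: constant on `Q`, zero outside `Q`, and bounded by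
`|Q|^{s - 1/p}`. -/
def souzaAtoms (m : Measure Ω) (s p : ℝ) (Q : Set Ω) : Set (Ω → ℂ) :=
  {a | (∀ x ∉ Q, a x = 0) ∧ (∃ z : ℂ, ∀ x ∈ Q, a x = z) ∧
    eLpNorm a ∞ m ≤ ENNReal.ofReal (m.real Q ^ (s - 1 / p))}

/-- The grid induced on an element `Q` of level `k₀`. -/
def inducedGrid (P : ℕ → Finset (Set Ω)) (k₀ : ℕ) (Q : Set Ω) : ℕ → Finset (Set Ω) :=
  open Classical in
  fun i => (P (k₀ + i)).filter (fun R => R ⊆ Q)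

/-- The normalizing constant `M^{1 + 1/p} (∑ₖ c₂^{kβq})^{1/q}` of the Besov atoms, where `M` is
the overlap constant of the grid, with a supremum over `k` if `q = ∞`. -/
def besovAtomConst (P : ℕ → Finset (Set Ω)) (c₂ β p : ℝ) (q : ℝ≥0∞) : ℝ≥0∞ :=
  open Classical in
  gridMult P ^ (1 + 1 / p) *
    (if q = ∞ then ⨆ k : ℕ, ENNReal.ofReal (c₂ ^ (k * β))
    else (∑' k : ℕ, ENNReal.ofReal (c₂ ^ (k * β * q.toReal))) ^ (1 / q.toReal))

/-- The `(s, β, p, q)`-Besov atoms on an element `Q` of the grid: functions vanishing outside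
`Q` that lie in the Besov space of smoothness `β` of the measure space `Q` with the induced grid,
with norm at most `|Q|^{s - β}` divided by the normalizing constant. -/
def besovAtoms (m : Measure Ω) (P : ℕ → Finset (Set Ω)) (c₂ s β p : ℝ) (q : ℝ≥0∞)
    (Q : Set Ω) : Set (Ω → ℂ) :=
  {a | (∀ x ∉ Q, a x = 0) ∧ ∃ k₀, Q ∈ P k₀ ∧
    a ∈ besovSpace (m.restrict Q) (inducedGrid P k₀ Q) (souzaAtoms (m.restrict Q) β p) p q ∧
    besovNorm (m.restrict Q) (inducedGrid P k₀ Q) (souzaAtoms (m.restrict Q) β p) p q a ≤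
      (besovAtomConst P c₂ β p q)⁻¹ * ENNReal.ofReal (m.real Q ^ (s - β))}

/-- The `1/β`-variation `sup (∑ᵢ |a(x_{i+1}) - a(x_i)|^{1/β})^β` of `a`, the supremum being over
all finite sequences `x₀ < x₁ < ⋯ < xₙ` in `S`. -/
def powerVar (β : ℝ) (a : ℝ → ℂ) (S : Set ℝ) : ℝ≥0∞ :=
  ⨆ (n : ℕ) (x : Fin (n + 1) → ℝ) (_ : StrictMono x) (_ : ∀ i, x i ∈ S),
    (∑ i : Fin n, ‖a (x i.succ) - a (x i.castSucc)‖ₑ ^ (1 / β)) ^ β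

/-- The `(s, β, p)`-bounded variation atoms on `Q`. -/
def bvAtoms (m : Measure ℝ) (s β p : ℝ) (Q : Set ℝ) : Set (ℝ → ℂ) :=
  {a | (∀ x ∉ Q, a x = 0) ∧
    eLpNorm a ∞ m ≤ ENNReal.ofReal (m.real Q ^ (s - 1 / p)) ∧
    powerVar β a (interior Q) ≤ ENNReal.ofReal (m.real Q ^ (s - 1 / p))}

end BesovGrid

end

/-!
A Souza atom is constant on its interval, so it has zero variation and is an atom of bounded
variation. The converse is an atomic decomposition. For `g = ∑ₖ ∑_{Q ∈ Pᵏ} c_Q a_Q` with atoms of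
bounded variation, let `Sₖ` be the part of the series up to level `k` and replace it by the step
function that takes on each `R ∈ Pᵏ` the value of `Sₖ` at an interior point of `R`. The difference
of two consecutive step functions is a combination of Souza atoms of level `k`, whose coefficients
are controlled by `c_R` and by the oscillations over the parent of `R` of the terms `c_Q a_Q` of the
earlier levels.

For `R` running through the level-`k` descendants of an element `Q` of level `j ≤ k`, the
`1/β`-variations of `a_Q` over the intervals `R` add up to at most the variation over `Q`. As
`β ≤ 1/p`, Hölder's inequality with the weights `|R|` turns this into an `ℓᵖ` bound with a gain
`c₂^{(β - s)(k - j)}`. Hence the level costs of the new coefficients are bounded by a convolution of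
the old ones with a geometric sequence. For `s < β` this sequence is summable and Young's inequality
in `ℓ^q` compares the norms; when all of the old cost sits on level `0`, as for a single atom, the
new costs are themselves a geometric sequence, which for `s = β` is still bounded.
-/

noncomputable section

namespace BesovGrid

open Measure in
theorem eLpNorm_count_eq_tsum {q : ℝ≥0∞} (hq₀ : q ≠ 0) (hq : q ≠ ∞) (x : ℕ → ℝ≥0∞) :
    eLpNorm x q count = (∑' k, x k ^ q.toReal) ^ (1 / q.toReal) := by
  simp [eLpNorm_eq_lintegral_rpow_enorm_toReal hq₀ hq, lintegral_count]

theorem sum_range_pow_sub_le (ρ : ℝ≥0∞) (k : ℕ) :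
    ∑ j ∈ Finset.range (k + 1), ρ ^ (k - j) ≤ (1 - ρ)⁻¹ := by
  rw [← ENNReal.tsum_geometric]
  exact (Finset.sum_range_reflect (ρ ^ ·) (k + 1)).trans_le (ENNReal.sum_le_tsum _)

theorem pow_rpow_comm (x : ℝ≥0∞) (n : ℕ) (s : ℝ) : (x ^ n) ^ s = (x ^ s) ^ n := by
  rw [← ENNReal.rpow_natCast_mul, mul_comm, ENNReal.rpow_mul_natCast]

theorem tsum_sum_range_pow_mul (ρ : ℝ≥0∞) (x : ℕ → ℝ≥0∞) :
    ∑' k, ∑ j ∈ Finset.range (k + 1), ρ ^ (k - j) * x j = (1 - ρ)⁻¹ * ∑' j, x j := by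
  rw [← ENNReal.tsum_geometric, ← ENNReal.tsum_mul_right]
  simp_rw [← ENNReal.tsum_mul_left]
  rw [← ENNReal.tsum_prod,
    ← Finset.HasAntidiagonal.sigmaAntidiagonalEquivProd.tsum_eq (_ : ℕ × ℕ → ℝ≥0∞),
    ENNReal.tsum_sigma']
  refine tsum_congr fun k => ?_
  rw [← Finset.Nat.sum_antidiagonal_eq_sum_range_succ (fun j i => ρ ^ i * x j), tsum_fintype,
    ← Finset.Nat.sum_antidiagonal_swap, ← Finset.sum_coe_sort]
  rfl

theorem rpow_sum_range_pow_mul_le {r : ℝ} (hr : 1 ≤ r) (ρ : ℝ≥0∞) (x : ℕ → ℝ≥0∞) (k : ℕ) :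
    (∑ j ∈ Finset.range (k + 1), ρ ^ (k - j) * x j) ^ r ≤
      (1 - ρ)⁻¹ ^ (r - 1) * ∑ j ∈ Finset.range (k + 1), ρ ^ (k - j) * x j ^ r := by
  have hr₀ : 0 < r := by linarith
  have hölder := ENNReal.inner_le_weight_mul_Lp_of_nonneg (Finset.range (k + 1)) hr
    (fun j => ρ ^ (k - j)) x
  calc (∑ j ∈ Finset.range (k + 1), ρ ^ (k - j) * x j) ^ r
      ≤ (∑ j ∈ Finset.range (k + 1), ρ ^ (k - j)) ^ (r - 1) *
          ∑ j ∈ Finset.range (k + 1), ρ ^ (k - j) * x j ^ r := by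
        refine (ENNReal.rpow_le_rpow hölder hr₀.le).trans_eq ?_
        rw [ENNReal.mul_rpow_of_nonneg _ _ hr₀.le, ← ENNReal.rpow_mul, ← ENNReal.rpow_mul,
          inv_mul_cancel₀ hr₀.ne', ENNReal.rpow_one, sub_mul, inv_mul_cancel₀ hr₀.ne', one_mul]
    _ ≤ _ := by
        gcongr
        exact sum_range_pow_sub_le ρ k

theorem eLpNorm_geometric_convolution_le {q : ℝ≥0∞} (hq : 1 ≤ q) (ρ : ℝ≥0∞) (x : ℕ → ℝ≥0∞) :
    eLpNorm (fun k => ∑ j ∈ Finset.range (k + 1), ρ ^ (k - j) * x j) q Measure.count ≤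
      (1 - ρ)⁻¹ * eLpNorm x q Measure.count := by
  rcases eq_or_ne q ∞ with rfl | hq_top
  · simp only [eLpNorm_exponent_top, eLpNormEssSup_count, enorm_eq_self]
    refine iSup_le fun k => ?_
    calc ∑ j ∈ Finset.range (k + 1), ρ ^ (k - j) * x j
        ≤ ∑ j ∈ Finset.range (k + 1), ρ ^ (k - j) * ⨆ i, x i := by
          gcongr with j
          exact le_iSup x j
      _ ≤ (1 - ρ)⁻¹ * ⨆ i, x i := by
          rw [← Finset.sum_mul]
          gcongr
          exact sum_range_pow_sub_le ρ k
  · have hq₀ : q ≠ 0 := (one_pos.trans_le hq).ne'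
    have hr : 1 ≤ q.toReal := by simpa using ENNReal.toReal_mono hq_top hq
    set r := q.toReal
    have hr₀ : 0 < r := by linarith
    rw [eLpNorm_count_eq_tsum hq₀ hq_top, eLpNorm_count_eq_tsum hq₀ hq_top, one_div,
      ENNReal.rpow_inv_le_iff hr₀, ENNReal.mul_rpow_of_nonneg _ _ hr₀.le,
      ENNReal.rpow_inv_rpow hr₀.ne']
    calc ∑' k, (∑ j ∈ Finset.range (k + 1), ρ ^ (k - j) * x j) ^ r
        ≤ ∑' k, (1 - ρ)⁻¹ ^ (r - 1) * ∑ j ∈ Finset.range (k + 1), ρ ^ (k - j) * x j ^ r :=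
          ENNReal.tsum_le_tsum (rpow_sum_range_pow_mul_le hr ρ x)
      _ = (1 - ρ)⁻¹ ^ r * ∑' k, x k ^ r := by
          rw [ENNReal.tsum_mul_left, tsum_sum_range_pow_mul, ← mul_assoc]
          congr 1
          nth_rw 2 [← ENNReal.rpow_one (1 - ρ)⁻¹]
          rw [← ENNReal.rpow_add_of_nonneg _ _ (by linarith) zero_le_one, sub_add_cancel]

theorem eLpNorm_count_single_le {q : ℝ≥0∞} (hq : q ≠ 0) (z : ℝ≥0∞) :
    eLpNorm (Pi.single 0 z : ℕ → ℝ≥0∞) q Measure.count ≤ z := by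
  rcases eq_or_ne q ∞ with rfl | hq_top
  · simp only [eLpNorm_exponent_top, eLpNormEssSup_count, enorm_eq_self, iSup_le_iff]
    intro k
    rw [Pi.single_apply]
    split_ifs <;> simp
  · have hr : 0 < q.toReal := ENNReal.toReal_pos hq hq_top
    rw [eLpNorm_count_eq_tsum hq hq_top, tsum_eq_single 0 fun k hk => by
      rw [Pi.single_eq_of_ne hk, ENNReal.zero_rpow_of_pos hr], Pi.single_eq_same, one_div,
      ENNReal.rpow_rpow_inv hr.ne']

theorem eLpNorm_geometric_le {q : ℝ≥0∞} (hq : 1 ≤ q) (ρ : ℝ≥0∞) :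
    eLpNorm (fun k => ρ ^ k) q Measure.count ≤ (1 - ρ)⁻¹ := by
  have hconv : (fun k => ρ ^ k) =
      fun k => ∑ j ∈ Finset.range (k + 1), ρ ^ (k - j) * (Pi.single 0 1 : ℕ → ℝ≥0∞) j := by
    funext k
    rw [Finset.sum_eq_single_of_mem 0 (by simp) fun j _ hj => by simp [hj]]
    simp
  rw [hconv]
  refine (eLpNorm_geometric_convolution_le hq ρ _).trans (mul_le_of_le_one_right' ?_)
  exact eLpNorm_count_single_le (one_pos.trans_le hq).ne' 1

theorem eLpNorm_top_geometric_le_one {ρ : ℝ≥0∞} (hρ : ρ ≤ 1) :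
    eLpNorm (fun k : ℕ => ρ ^ k) ∞ Measure.count ≤ 1 := by
  simpa using fun k => pow_le_one₀ zero_le hρ

section FiniteSums

variable {ι : Type*} {p : ℝ} {F : Finset ι} {v w : ι → ℝ≥0∞}

/-- The `ℓᵖ` norm of a family of extended nonnegative reals over a finite set of indices. -/
def lpSum (p : ℝ) (F : Finset ι) (v : ι → ℝ≥0∞) : ℝ≥0∞ :=
  (∑ i ∈ F, v i ^ p) ^ (1 / p)

theorem lpSum_mono (hp : 0 ≤ p) (h : ∀ i ∈ F, v i ≤ w i) : lpSum p F v ≤ lpSum p F w := by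
  unfold lpSum
  gcongr with i hi
  exact h i hi

theorem lpSum_add_le (hp : 1 ≤ p) :
    lpSum p F (fun i => v i + w i) ≤ lpSum p F v + lpSum p F w :=
  ENNReal.Lp_add_le F v w hp

theorem lpSum_const_mul (hp : 0 < p) (D : ℝ≥0∞) :
    lpSum p F (fun i => D * v i) = D * lpSum p F v := by
  simp only [lpSum, ENNReal.mul_rpow_of_nonneg _ _ hp.le, ← Finset.mul_sum]
  rw [ENNReal.mul_rpow_of_nonneg _ _ (by positivity), one_div, ENNReal.rpow_rpow_inv hp.ne']

theorem lpSum_sum_le {κ : Type*} (hp : 1 ≤ p) (T : Finset κ) (f : κ → ι → ℝ≥0∞) :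
    lpSum p F (fun i => ∑ j ∈ T, f j i) ≤ ∑ j ∈ T, lpSum p F (f j) := by
  have hp₀ : 0 < p := by linarith
  have hzero : lpSum p F (0 : ι → ℝ≥0∞) = 0 := by simp [lpSum, hp₀]
  simpa only [Finset.sum_fn] using
    Finset.le_sum_of_subadditive (lpSum p F) hzero.le (fun _ _ => lpSum_add_le hp) T f

theorem lpSum_rpow (hp : 0 < p) : lpSum p F v ^ p = ∑ i ∈ F, v i ^ p := by
  rw [lpSum, one_div, ENNReal.rpow_inv_rpow hp.ne']

theorem sum_rpow_mul_rpow_le {r : ℝ} (hr₀ : 0 ≤ r) (hr₁ : r ≤ 1) :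
    ∑ i ∈ F, v i ^ (1 - r) * w i ^ r ≤ (∑ i ∈ F, v i) ^ (1 - r) * (∑ i ∈ F, w i) ^ r := by
  let _ : MeasurableSpace F := ⊤
  have hölder := ENNReal.lintegral_mul_norm_pow_le (α := F) (μ := Measure.count)
    (f := fun i => v i) (g := fun i => w i) measurable_from_top.aemeasurable
    measurable_from_top.aemeasurable (sub_nonneg.2 hr₁) hr₀ (sub_add_cancel 1 r)
  simpa only [lintegral_count, tsum_fintype, Finset.univ_eq_attach, Finset.sum_attach F v,
    Finset.sum_attach F w, Finset.sum_attach F fun i => v i ^ (1 - r) * w i ^ r] using hölder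

/-- **Hölder's inequality** with the exponents `1 / (1 / p - β)` and `1 / β`. -/
theorem lpSum_rpow_mul_rpow_le {β : ℝ} (hp : 0 < p) (hβ : 0 ≤ β) (hβp : β ≤ 1 / p) :
    lpSum p F (fun i => v i ^ (1 / p - β) * w i ^ β) ≤
      (∑ i ∈ F, v i) ^ (1 / p - β) * (∑ i ∈ F, w i) ^ β := by
  have hpβ : β * p ≤ 1 := (le_div_iff₀ hp).1 hβp
  have hexp : (1 / p - β) * p = 1 - β * p := by rw [sub_mul, one_div_mul_cancel hp.ne']
  rw [lpSum, one_div, ENNReal.rpow_inv_le_iff hp]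
  simp only [ENNReal.mul_rpow_of_nonneg _ _ hp.le, ← ENNReal.rpow_mul, ← one_div, hexp]
  exact sum_rpow_mul_rpow_le (mul_nonneg hβ hp.le) hpβ

end FiniteSums

section Costs

variable {Ω : Type*} {p : ℝ} {P : ℕ → Finset (Set Ω)} {c e : Set Ω → ℂ}

/-- The contribution `(∑_{Q ∈ Pᵏ} |c_Q|ᵖ)^{1/p}` of level `k` to the cost. -/
def levelCost (p : ℝ) (P : ℕ → Finset (Set Ω)) (c : Set Ω → ℂ) (k : ℕ) : ℝ≥0∞ :=
  lpSum p (P k) (‖c ·‖ₑ)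

theorem cost_eq_eLpNorm {q : ℝ≥0∞} (hq : q ≠ 0) :
    cost p q P c = eLpNorm (levelCost p P c) q Measure.count := by
  rcases eq_or_ne q ∞ with rfl | hq_top
  · simp [cost, levelCost, lpSum]
  · simp only [cost, if_neg hq_top, eLpNorm_count_eq_tsum hq hq_top, levelCost, lpSum,
      ← ENNReal.rpow_mul, one_div_mul_eq_div]

theorem levelCost_le_cost {q : ℝ≥0∞} (hq : q ≠ 0) (k : ℕ) : levelCost p P c k ≤ cost p q P c := by
  rw [cost_eq_eLpNorm hq]
  exact enorm_le_eLpNorm_count (levelCost p P c) k hq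

theorem cost_le_of_levelCost_le {q : ℝ≥0∞} (hq : q ≠ 0) {D : ℝ≥0∞} {x : ℕ → ℝ≥0∞}
    (h : ∀ k, levelCost p P c k ≤ D * x k) :
    cost p q P c ≤ D * eLpNorm x q Measure.count := by
  rw [cost_eq_eLpNorm hq]
  exact eLpNorm_le_mul_eLpNorm_of_ae_le_mul'' q measurable_from_nat.aestronglyMeasurable
    (Eventually.of_forall h)

theorem cost_le_of_levelCost_le_convolution {q : ℝ≥0∞} (hq : 1 ≤ q) {D ρ : ℝ≥0∞}
    (h : ∀ k, levelCost p P e k ≤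
      D * ∑ j ∈ Finset.range (k + 1), ρ ^ (k - j) * levelCost p P c j) :
    cost p q P e ≤ D * (1 - ρ)⁻¹ * cost p q P c := by
  have hq₀ : q ≠ 0 := (one_pos.trans_le hq).ne'
  calc cost p q P e ≤ D * _ := cost_le_of_levelCost_le hq₀ h
    _ ≤ D * ((1 - ρ)⁻¹ * cost p q P c) := by
        rw [cost_eq_eLpNorm hq₀]
        gcongr
        exact eLpNorm_geometric_convolution_le hq ρ _
    _ = _ := (mul_assoc _ _ _).symm

theorem besovAtomConst_eq_eLpNorm {c₂ β : ℝ} (hc₂ : 0 ≤ c₂) {q : ℝ≥0∞} (hq : q ≠ 0) :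
    besovAtomConst P c₂ β p q = gridMult P ^ (1 + 1 / p) *
      eLpNorm (fun k => ENNReal.ofReal (c₂ ^ β) ^ k) q Measure.count := by
  have hpow (k : ℕ) : ENNReal.ofReal (c₂ ^ (k * β)) = ENNReal.ofReal (c₂ ^ β) ^ k := by
    rw [← ENNReal.ofReal_pow (by positivity), ← Real.rpow_natCast, ← Real.rpow_mul hc₂, mul_comm]
  rcases eq_or_ne q ∞ with rfl | hq_top
  · simp [besovAtomConst, hpow]
  · simp only [besovAtomConst, if_neg hq_top, eLpNorm_count_eq_tsum hq hq_top, ← hpow]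
    simp_rw [ENNReal.ofReal_rpow_of_nonneg (Real.rpow_nonneg hc₂ _) ENNReal.toReal_nonneg,
      ← Real.rpow_mul hc₂]

end Costs

section Grids

variable {Ω : Type*} {P : ℕ → Finset (Set Ω)}

/-- The element of level `k` that contains `R`, or `∅` if there is none. -/
def ancestor (P : ℕ → Finset (Set Ω)) (k : ℕ) (R : Set Ω) : Set Ω :=
  open Classical in if h : ∃ S ∈ P k, R ⊆ S then h.choose else ∅

/-- The level of an element of the grid, with the junk value `0` for other sets. -/
def level (P : ℕ → Finset (Set Ω)) (R : Set Ω) : ℕ :=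
  open Classical in if h : ∃ k, R ∈ P k then h.choose else 0

/-- The elements of level `k` contained in `Q`. -/
def descendants (P : ℕ → Finset (Set Ω)) (k : ℕ) (Q : Set Ω) : Finset (Set Ω) :=
  open Classical in (P k).filter (· ⊆ Q)

theorem mem_descendants {k : ℕ} {Q R : Set Ω} : R ∈ descendants P k Q ↔ R ∈ P k ∧ R ⊆ Q := by
  simp [descendants]

theorem mem_inducedGrid [MeasurableSpace Ω] {k₀ i : ℕ} {Q R : Set Ω} :
    R ∈ inducedGrid P k₀ Q i ↔ R ∈ P (k₀ + i) ∧ R ⊆ Q := by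
  simp [inducedGrid]

variable [MeasurableSpace Ω] {m : Measure Ω} {κ θ : ℝ≥0∞}

/-- A sequence of successively finer partitions of the measure space, up to null sets, into finitely
many sets of positive measure: an element contained in an element `R` of the preceding level has
measure between `κ * m R` and `θ * m R`. These are the properties of a good grid that are inherited
by the grids it induces on its elements. -/
structure IsRefiningGrid (m : Measure Ω) (P : ℕ → Finset (Set Ω)) (κ θ : ℝ≥0∞) : Prop where
  κ_ne_zero : κ ≠ 0
  θ_lt_one : θ < 1
  measurable : ∀ k, ∀ Q ∈ P k, MeasurableSet Q
  pos : ∀ k, ∀ Q ∈ P k, 0 < m Q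
  cover : ∀ k, ∀ᵐ x ∂m, ∃ Q ∈ P k, x ∈ Q
  disjoint : ∀ k, ∀ Q ∈ P k, ∀ R ∈ P k, Q ≠ R → Disjoint Q R
  nested : ∀ k, ∀ Q ∈ P (k + 1), ∃ R ∈ P k, Q ⊆ R
  lower : ∀ k, ∀ R ∈ P k, ∀ Q ∈ P (k + 1), Q ⊆ R → κ * m R ≤ m Q
  upper : ∀ k, ∀ R ∈ P k, ∀ Q ∈ P (k + 1), Q ⊆ R → m Q ≤ θ * m R

namespace IsRefiningGrid

variable {i j k : ℕ} {Q R : Set Ω}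

theorem nonempty (h : IsRefiningGrid m P κ θ) (hR : R ∈ P k) : R.Nonempty :=
  nonempty_of_measure_ne_zero (h.pos k R hR).ne'

theorem eq_of_mem (h : IsRefiningGrid m P κ θ) (hQ : Q ∈ P k) (hR : R ∈ P k) {x : Ω}
    (hxQ : x ∈ Q) (hxR : x ∈ R) : Q = R :=
  by_contra fun hne => Set.disjoint_left.1 (h.disjoint k Q hQ R hR hne) hxQ hxR

theorem exists_superset (h : IsRefiningGrid m P κ θ) (hjk : j ≤ k) (hR : R ∈ P k) :
    ∃ Q ∈ P j, R ⊆ Q := by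
  induction k, hjk using Nat.le_induction generalizing R with
  | base => exact ⟨R, hR, subset_rfl⟩
  | succ k _ ih =>
    obtain ⟨S, hS, hRS⟩ := h.nested k R hR
    obtain ⟨Q, hQ, hSQ⟩ := ih hS
    exact ⟨Q, hQ, hRS.trans hSQ⟩

theorem ancestor_mem (h : IsRefiningGrid m P κ θ) (hjk : j ≤ k) (hR : R ∈ P k) :
    ancestor P j R ∈ P j := by
  have hex := h.exists_superset hjk hR
  rw [ancestor, dif_pos hex]
  exact hex.choose_spec.1

theorem subset_ancestor (h : IsRefiningGrid m P κ θ) (hjk : j ≤ k) (hR : R ∈ P k) :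
    R ⊆ ancestor P j R := by
  have hex := h.exists_superset hjk hR
  rw [ancestor, dif_pos hex]
  exact hex.choose_spec.2

theorem ancestor_eq_of_mem (h : IsRefiningGrid m P κ θ) (hjk : j ≤ k) (hR : R ∈ P k)
    (hQ : Q ∈ P j) {x : Ω} (hxR : x ∈ R) (hxQ : x ∈ Q) : ancestor P j R = Q :=
  h.eq_of_mem (h.ancestor_mem hjk hR) hQ (h.subset_ancestor hjk hR hxR) hxQ

theorem ancestor_eq (h : IsRefiningGrid m P κ θ) (hjk : j ≤ k) (hR : R ∈ P k) (hQ : Q ∈ P j)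
    (hRQ : R ⊆ Q) : ancestor P j R = Q :=
  let ⟨_, hx⟩ := h.nonempty hR
  h.ancestor_eq_of_mem hjk hR hQ hx (hRQ hx)

theorem ancestor_ancestor (h : IsRefiningGrid m P κ θ) (hij : i ≤ j) (hjk : j ≤ k) (hR : R ∈ P k) :
    ancestor P i (ancestor P j R) = ancestor P i R :=
  let ⟨_, hx⟩ := h.nonempty hR
  h.ancestor_eq_of_mem hij (h.ancestor_mem hjk hR) (h.ancestor_mem (hij.trans hjk) hR)
    (h.subset_ancestor hjk hR hx) (h.subset_ancestor (hij.trans hjk) hR hx)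

theorem subset_of_mem (h : IsRefiningGrid m P κ θ) (hjk : j ≤ k) (hR : R ∈ P k) (hQ : Q ∈ P j)
    {x : Ω} (hxR : x ∈ R) (hxQ : x ∈ Q) : R ⊆ Q :=
  h.ancestor_eq_of_mem hjk hR hQ hxR hxQ ▸ h.subset_ancestor hjk hR

theorem measure_le_pow_mul (h : IsRefiningGrid m P κ θ) (hjk : j ≤ k) (hR : R ∈ P k)
    (hQ : Q ∈ P j) (hRQ : R ⊆ Q) : m R ≤ θ ^ (k - j) * m Q := by
  induction k, hjk using Nat.le_induction generalizing R with
  | base => simpa using measure_mono hRQ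
  | succ k hjk ih =>
    obtain ⟨S, hS, hRS⟩ := h.nested k R hR
    obtain ⟨x, hx⟩ := h.nonempty hR
    have hSQ : S ⊆ Q := h.subset_of_mem hjk hS hQ (hRS hx) (hRQ hx)
    calc m R ≤ θ * m S := h.upper k S hS R hR hRS
      _ ≤ θ * (θ ^ (k - j) * m Q) := by gcongr; exact ih hS hSQ
      _ = θ ^ (k + 1 - j) * m Q := by rw [Nat.succ_sub hjk, pow_succ']; ring

theorem measure_le_pow (h : IsRefiningGrid m P κ θ) (hR : R ∈ P k) :
    m R ≤ θ ^ k * m Set.univ := by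
  obtain ⟨Q, hQ, hRQ⟩ := h.exists_superset k.zero_le hR
  calc m R ≤ θ ^ (k - 0) * m Q := h.measure_le_pow_mul k.zero_le hR hQ hRQ
    _ ≤ θ ^ k * m Set.univ := by
        rw [Nat.sub_zero]
        gcongr
        exact Set.subset_univ Q

theorem level_le_of_mem [IsFiniteMeasure m] (h : IsRefiningGrid m P κ θ) (hi : R ∈ P i)
    (hj : R ∈ P j) : j ≤ i := by
  by_contra! hij
  have hlt : m R < m R := calc
    m R ≤ θ ^ (j - i) * m R := h.measure_le_pow_mul hij.le hj hi subset_rfl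
    _ < 1 * m R := ENNReal.mul_lt_mul_left (h.pos i R hi).ne' (measure_ne_top m R)
        (pow_lt_one₀ zero_le h.θ_lt_one (Nat.sub_pos_of_lt hij).ne')
    _ = m R := one_mul _
  exact hlt.false

theorem level_unique [IsFiniteMeasure m] (h : IsRefiningGrid m P κ θ) (hi : R ∈ P i)
    (hj : R ∈ P j) : i = j :=
  (h.level_le_of_mem hj hi).antisymm (h.level_le_of_mem hi hj)

theorem level_eq [IsFiniteMeasure m] (h : IsRefiningGrid m P κ θ) (hR : R ∈ P k) :
    level P R = k := by
  have hex : ∃ k, R ∈ P k := ⟨k, hR⟩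
  rw [level, dif_pos hex]
  exact h.level_unique hex.choose_spec hR

theorem sum_descendants_measure_le (h : IsRefiningGrid m P κ θ) (k : ℕ) (Q : Set Ω) :
    ∑ R ∈ descendants P k Q, m R ≤ m Q := by
  have hdisj : (descendants P k Q : Set (Set Ω)).PairwiseDisjoint id := fun R hR R' hR' =>
    h.disjoint k R (mem_descendants.1 hR).1 R' (mem_descendants.1 hR').1
  refine (measure_biUnion_finset hdisj
    fun R hR => h.measurable k R (mem_descendants.1 hR).1).symm.trans_le ?_
  exact measure_mono (Set.iUnion₂_subset fun R hR => (mem_descendants.1 hR).2)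

theorem card_children_le [IsFiniteMeasure m] (h : IsRefiningGrid m P κ θ) (hQ : Q ∈ P k) :
    ((descendants P (k + 1) Q).card : ℝ≥0∞) ≤ κ⁻¹ := by
  rw [ENNReal.le_inv_iff_mul_le]
  refine (ENNReal.mul_le_mul_iff_left (h.pos k Q hQ).ne' (measure_ne_top m Q)).1 ?_
  calc ((descendants P (k + 1) Q).card : ℝ≥0∞) * κ * m Q
      = ∑ _R ∈ descendants P (k + 1) Q, κ * m Q := by simp [mul_assoc]
    _ ≤ ∑ R ∈ descendants P (k + 1) Q, m R := Finset.sum_le_sum fun R hR =>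
        h.lower k Q hQ R (mem_descendants.1 hR).1 (mem_descendants.1 hR).2
    _ ≤ 1 * m Q := (h.sum_descendants_measure_le _ _).trans_eq (one_mul _).symm

theorem sum_eq_sum_descendants (h : IsRefiningGrid m P κ θ) {M : Type*} [AddCommMonoid M]
    (hjk : j ≤ k) (f : Set Ω → M) :
    ∑ R ∈ P k, f R = ∑ Q ∈ P j, ∑ R ∈ descendants P k Q, f R := by
  classical
  rw [← Finset.sum_fiberwise_of_maps_to (s := P k) (t := P j) (g := ancestor P j)
    fun R hR => h.ancestor_mem hjk hR]
  refine Finset.sum_congr rfl fun Q hQ => Finset.sum_congr ?_ fun _ _ => rfl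
  ext R
  rw [Finset.mem_filter, mem_descendants, and_congr_right_iff]
  exact fun hR => ⟨fun hRQ => hRQ ▸ h.subset_ancestor hjk hR, h.ancestor_eq hjk hR hQ⟩

theorem sum_parent_le [IsFiniteMeasure m] (h : IsRefiningGrid m P κ θ) (k : ℕ)
    (f : Set Ω → ℝ≥0∞) :
    ∑ R ∈ P (k + 1), f (ancestor P k R) ≤ κ⁻¹ * ∑ Q ∈ P k, f Q := by
  rw [h.sum_eq_sum_descendants k.le_succ, Finset.mul_sum]
  refine Finset.sum_le_sum fun Q hQ => ?_
  calc ∑ R ∈ descendants P (k + 1) Q, f (ancestor P k R)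
      = ∑ _R ∈ descendants P (k + 1) Q, f Q := Finset.sum_congr rfl fun R hR => by
        rw [h.ancestor_eq k.le_succ (mem_descendants.1 hR).1 hQ (mem_descendants.1 hR).2]
    _ ≤ κ⁻¹ * f Q := by
        rw [Finset.sum_const, nsmul_eq_mul]
        gcongr
        exact h.card_children_le hQ

theorem induced (h : IsRefiningGrid m P κ θ) {k₀ : ℕ} (hQ : Q ∈ P k₀) :
    IsRefiningGrid (m.restrict Q) (inducedGrid P k₀ Q) κ θ where
  κ_ne_zero := h.κ_ne_zero
  θ_lt_one := h.θ_lt_one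
  measurable k R hR := h.measurable _ R (mem_inducedGrid.1 hR).1
  pos k R hR := by
    rw [Measure.restrict_eq_self _ (mem_inducedGrid.1 hR).2]
    exact h.pos _ R (mem_inducedGrid.1 hR).1
  cover k := by
    filter_upwards [ae_restrict_mem (h.measurable _ Q hQ),
      ae_restrict_of_ae (h.cover (k₀ + k))] with x hxQ ⟨R, hR, hxR⟩
    exact ⟨R, mem_inducedGrid.2 ⟨hR, h.subset_of_mem (k₀.le_add_right k) hR hQ hxR hxQ⟩, hxR⟩
  disjoint k R hR R' hR' := h.disjoint _ R (mem_inducedGrid.1 hR).1 R' (mem_inducedGrid.1 hR').1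
  nested k R hR := by
    obtain ⟨hR, hRQ⟩ := mem_inducedGrid.1 hR
    obtain ⟨S, hS, hRS⟩ := h.nested (k₀ + k) R hR
    obtain ⟨x, hx⟩ := h.nonempty hR
    exact ⟨S, mem_inducedGrid.2
      ⟨hS, h.subset_of_mem (k₀.le_add_right k) hS hQ (hRS hx) (hRQ hx)⟩, hRS⟩
  lower k R hR S hS hSR := by
    rw [Measure.restrict_eq_self _ (mem_inducedGrid.1 hR).2,
      Measure.restrict_eq_self _ (mem_inducedGrid.1 hS).2]
    exact h.lower _ R (mem_inducedGrid.1 hR).1 S (mem_inducedGrid.1 hS).1 hSR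
  upper k R hR S hS hSR := by
    rw [Measure.restrict_eq_self _ (mem_inducedGrid.1 hR).2,
      Measure.restrict_eq_self _ (mem_inducedGrid.1 hS).2]
    exact h.upper _ R (mem_inducedGrid.1 hR).1 S (mem_inducedGrid.1 hS).1 hSR

theorem inducedGrid_zero (h : IsRefiningGrid m P κ θ) {k₀ : ℕ} (hQ : Q ∈ P k₀) :
    inducedGrid P k₀ Q 0 = {Q} := by
  ext R
  rw [mem_inducedGrid, Finset.mem_singleton]
  refine ⟨fun ⟨hR, hRQ⟩ => ?_, fun hRQ => ⟨hRQ ▸ hQ, hRQ.subset⟩⟩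
  obtain ⟨x, hx⟩ := h.nonempty hR
  exact h.eq_of_mem hR hQ hx (hRQ hx)

theorem nullSingletonClass [IsFiniteMeasure m] (h : IsRefiningGrid m P κ θ) :
    NullSingletonClass m where
  measure_singleton x := by
    by_contra hx
    have hle (k : ℕ) : m {x} ≤ θ ^ k * m Set.univ := by
      obtain ⟨Q, hQ, hxQ⟩ : ∃ Q ∈ P k, x ∈ Q := by
        by_contra hnot
        exact hx (measure_mono_null (Set.singleton_subset_iff.2 hnot) (h.cover k))
      exact (measure_mono (Set.singleton_subset_iff.2 hxQ)).trans (h.measure_le_pow hQ)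
    have hlim : Tendsto (fun k => θ ^ k * m Set.univ) atTop (𝓝 0) := by
      simpa using ENNReal.Tendsto.mul_const
        (ENNReal.tendsto_pow_atTop_nhds_zero_of_lt_one h.θ_lt_one)
        (Or.inr (measure_ne_top m Set.univ))
    exact hx (le_zero_iff.1 (ge_of_tendsto' hlim hle))

end IsRefiningGrid

end Grids

section PowerVariation

variable {β : ℝ} {a : ℝ → ℂ} {S S₁ S₂ : Set ℝ}

theorem powerVar_rpow_le_iff (hβ : 0 < β) {c : ℝ≥0∞} :
    powerVar β a S ^ (1 / β) ≤ c ↔ ∀ (n : ℕ) (x : Fin (n + 1) → ℝ), StrictMono x →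
      (∀ i, x i ∈ S) → ∑ i : Fin n, ‖a (x i.succ) - a (x i.castSucc)‖ₑ ^ (1 / β) ≤ c := by
  rw [one_div, ENNReal.rpow_inv_le_iff hβ]
  simp only [powerVar, iSup_le_iff, ENNReal.rpow_le_rpow_iff hβ, one_div]

theorem sum_le_powerVar_rpow (hβ : 0 < β) {n : ℕ} {x : Fin (n + 1) → ℝ} (hx : StrictMono x)
    (hxS : ∀ i, x i ∈ S) :
    ∑ i : Fin n, ‖a (x i.succ) - a (x i.castSucc)‖ₑ ^ (1 / β) ≤ powerVar β a S ^ (1 / β) :=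
  (powerVar_rpow_le_iff hβ).1 le_rfl n x hx hxS

theorem powerVar_mono (hβ : 0 < β) (h : S₁ ⊆ S₂) : powerVar β a S₁ ≤ powerVar β a S₂ :=
  (ENNReal.rpow_le_rpow_iff (one_div_pos.2 hβ)).1 <| (powerVar_rpow_le_iff hβ).2
    fun _ _ hx hxS => sum_le_powerVar_rpow hβ hx fun i => h (hxS i)

theorem enorm_sub_le_powerVar (hβ : 0 < β) {x y : ℝ} (hx : x ∈ S) (hy : y ∈ S) :
    ‖a x - a y‖ₑ ≤ powerVar β a S := by
  wlog hyx : y < x generalizing x y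
  · rcases (not_lt.1 hyx).eq_or_lt with rfl | hxy
    · simp
    · exact enorm_sub_rev (a x) (a y) ▸ this hy hx hxy
  have hmono : StrictMono ![y, x] := Fin.strictMono_iff_lt_succ.2 (by simpa using hyx)
  have hmem : ∀ i, ![y, x] i ∈ S := Fin.forall_fin_two.2 ⟨hy, hx⟩
  have hle := sum_le_powerVar_rpow (a := a) hβ hmono hmem
  rw [Fin.sum_univ_one] at hle
  exact (ENNReal.rpow_le_rpow_iff (one_div_pos.2 hβ)).1 hle

theorem powerVar_eq_zero_of_const (hβ : 0 < β) {z : ℂ} (h : ∀ x ∈ S, a x = z) :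
    powerVar β a S = 0 := by
  have hle : powerVar β a S ^ (1 / β) ≤ 0 := (powerVar_rpow_le_iff hβ).2 fun n x _ hxS => by
    simp [h _ (hxS _), hβ]
  simpa [hβ, hβ.not_gt] using hle

theorem powerVar_const_mul_le (hβ : 0 < β) (z : ℂ) :
    powerVar β (fun x => z * a x) S ≤ ‖z‖ₑ * powerVar β a S := by
  have hβ' : 0 < 1 / β := one_div_pos.2 hβ
  rw [← ENNReal.rpow_le_rpow_iff hβ', powerVar_rpow_le_iff hβ,
    ENNReal.mul_rpow_of_nonneg _ _ hβ'.le]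
  intro n x hx hxS
  simp only [← mul_sub, enorm_mul, ENNReal.mul_rpow_of_nonneg _ _ hβ'.le, ← Finset.mul_sum]
  gcongr
  exact sum_le_powerVar_rpow hβ hx hxS

theorem strictMono_fin_append {n k : ℕ} {x : Fin n → ℝ} {y : Fin k → ℝ} (hx : StrictMono x)
    (hy : StrictMono y) (hxy : ∀ i j, x i < y j) : StrictMono (Fin.append x y) := by
  intro i j hij
  induction i using Fin.addCases <;> induction j using Fin.addCases <;>
    simp only [Fin.append_left, Fin.append_right]
  · exact hx ((Fin.strictMono_castAdd k).lt_iff_lt.1 hij)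
  · exact hxy _ _
  · exact absurd hij (by simp [Fin.lt_def]; omega)
  · exact hy ((Fin.strictMono_natAdd n).lt_iff_lt.1 hij)

theorem sum_add_sum_le_powerVar_rpow (hβ : 0 < β) {n k : ℕ} {x : Fin (n + 1) → ℝ}
    {y : Fin (k + 1) → ℝ} (hx : StrictMono x) (hy : StrictMono y) (hxS : ∀ i, x i ∈ S)
    (hyS : ∀ i, y i ∈ S) (hxy : ∀ i j, x i < y j) :
    ∑ i : Fin n, ‖a (x i.succ) - a (x i.castSucc)‖ₑ ^ (1 / β) +
      ∑ i : Fin k, ‖a (y i.succ) - a (y i.castSucc)‖ₑ ^ (1 / β) ≤ powerVar β a S ^ (1 / β) := by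
  have hmem (i) : Fin.append x y i ∈ S := by
    induction i using Fin.addCases <;> simp [hxS, hyS]
  have hmono : StrictMono (Fin.append x y) := strictMono_fin_append hx hy hxy
  refine le_trans ?_ (sum_le_powerVar_rpow (n := n + 1 + k) hβ hmono hmem)
  have hl (i : Fin (n + 1)) : Fin.append x y (i.castAdd k).castSucc = x i :=
    Fin.append_left x y i
  have hr (i : Fin k) : Fin.append x y (i.natAdd (n + 1)).castSucc = y i.castSucc :=
    Fin.append_right x y i.castSucc
  have hr' (i : Fin k) : Fin.append x y (i.natAdd (n + 1)).succ = y i.succ :=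
    Fin.append_right x y i.succ
  have hl' (i : Fin n) : Fin.append x y (i.castSucc.castAdd k).succ = x i.succ :=
    Fin.append_left x y i.succ
  rw [Fin.sum_univ_add, Fin.sum_univ_castSucc]
  simp only [hl, hr, hl', hr']
  gcongr
  exact le_self_add

theorem powerVar_rpow_add_le (hβ : 0 < β) (h₁ : S₁ ⊆ S) (h₂ : S₂ ⊆ S)
    (hlt : ∀ x ∈ S₁, ∀ y ∈ S₂, x < y) :
    powerVar β a S₁ ^ (1 / β) + powerVar β a S₂ ^ (1 / β) ≤ powerVar β a S ^ (1 / β) := by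
  set V := powerVar β a S ^ (1 / β)
  have hmono {T : Set ℝ} (hT : T ⊆ S) : powerVar β a T ^ (1 / β) ≤ V :=
    ENNReal.rpow_le_rpow (powerVar_mono hβ hT) (one_div_pos.2 hβ).le
  rcases eq_or_ne V ∞ with hV | hV
  · simp [hV]
  refine add_le_of_le_tsub_right_of_le (hmono h₂) ((powerVar_rpow_le_iff hβ).2 ?_)
  intro n x hx hxS
  have hxV := sum_le_powerVar_rpow (a := a) hβ hx fun i => h₁ (hxS i)
  refine ENNReal.le_sub_of_add_le_right (ne_top_of_le_ne_top hV (hmono h₂)) ?_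
  refine add_le_of_le_tsub_left_of_le hxV ((powerVar_rpow_le_iff hβ).2 fun k y hy hyS => ?_)
  refine ENNReal.le_sub_of_add_le_left (ne_top_of_le_ne_top hV hxV) ?_
  exact sum_add_sum_le_powerVar_rpow hβ hx hy (fun i => h₁ (hxS i)) (fun i => h₂ (hyS i))
    fun i j => hlt _ (hxS i) _ (hyS j)

theorem lt_of_disjoint_of_ordConnected (h₁ : S₁.OrdConnected) (h₂ : S₂.OrdConnected)
    (hd : Disjoint S₁ S₂) {u v x y : ℝ} (hu : u ∈ S₁) (hv : v ∈ S₂) (huv : u ≤ v) (hx : x ∈ S₁)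
    (hy : y ∈ S₂) : x < y := by
  by_contra! hyx
  rcases le_total u y with huy | hyu
  · exact Set.disjoint_left.1 hd (h₁.out hu hx ⟨huy, hyx⟩) hy
  · exact Set.disjoint_left.1 hd hu (h₂.out hy hv ⟨hyu, huv⟩)

theorem sum_powerVar_rpow_le (hβ : 0 < β) {ι : Type*} {T : Finset ι} {J : ι → Set ℝ}
    (hJ : ∀ i ∈ T, (J i).OrdConnected) (hne : ∀ i ∈ T, (J i).Nonempty)
    (hd : (T : Set ι).PairwiseDisjoint J) (hJS : ∀ i ∈ T, J i ⊆ S) :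
    ∑ i ∈ T, powerVar β a (J i) ^ (1 / β) ≤ powerVar β a S ^ (1 / β) := by
  classical
  choose! x hx using hne
  induction T using Finset.induction_on_max_value x generalizing S with
  | empty => simp
  | insert l T hlT hmax ih =>
    simp only [Finset.forall_mem_insert] at hJ hJS hx
    rw [Finset.coe_insert, Set.pairwiseDisjoint_insert_of_notMem (by simpa using hlT)] at hd
    rw [Finset.sum_insert hlT, add_comm]
    refine (add_le_add_left (ih hJ.2 hd.1 (S := ⋃ i ∈ T, J i)
      (fun i hi => Set.subset_biUnion_of_mem (u := J) hi) hx.2) _).trans ?_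
    refine powerVar_rpow_add_le hβ (Set.iUnion₂_subset hJS.2) hJS.1 fun y hy z hz => ?_
    obtain ⟨i, hi, hyi⟩ := Set.mem_iUnion₂.1 hy
    exact lt_of_disjoint_of_ordConnected (hJ.2 i hi) hJ.1 (hd.2 i hi).symm (hx.2 i hi) hx.1
      (hmax i hi) hyi hz

end PowerVariation

section StepFunctions

variable {Ω E : Type*} {F : Finset (Set Ω)}

/-- The sum of the constants `v R` on the sets `R` of a finite family: for a disjoint family, the
step function with the value `v R` on `R`. -/
def stepFun [AddCommMonoid E] (F : Finset (Set Ω)) (v : Set Ω → E) (x : Ω) : E :=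
  ∑ R ∈ F, R.indicator (fun _ => v R) x

theorem stepFun_apply [AddCommMonoid E] (hd : ∀ Q ∈ F, ∀ R ∈ F, Q ≠ R → Disjoint Q R)
    {R : Set Ω} (hR : R ∈ F) {x : Ω} (hx : x ∈ R) (v : Set Ω → E) : stepFun F v x = v R := by
  rw [stepFun, Finset.sum_eq_single_of_mem R hR, Set.indicator_of_mem hx]
  exact fun Q hQ hne => Set.indicator_of_notMem (Set.disjoint_right.1 (hd Q hQ R hR hne) hx) _

theorem stepFun_rpow (hd : ∀ Q ∈ F, ∀ R ∈ F, Q ≠ R → Disjoint Q R) {p : ℝ} (hp : 0 < p)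
    (v : Set Ω → ℝ≥0∞) (x : Ω) : stepFun F v x ^ p = stepFun F (fun R => v R ^ p) x := by
  by_cases hx : ∃ R ∈ F, x ∈ R
  · obtain ⟨R, hR, hx⟩ := hx
    rw [stepFun_apply hd hR hx, stepFun_apply hd hR hx]
  · push Not at hx
    have hzero (w : Set Ω → ℝ≥0∞) : stepFun F w x = 0 :=
      Finset.sum_eq_zero fun R hR => Set.indicator_of_notMem (hx R hR) _
    rw [hzero, hzero, ENNReal.zero_rpow_of_pos hp]

variable [MeasurableSpace Ω] {m : Measure Ω}

theorem stronglyMeasurable_stepFun [TopologicalSpace E] [AddCommMonoid E] [ContinuousAdd E]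
    (hF : ∀ R ∈ F, MeasurableSet R) (v : Set Ω → E) : StronglyMeasurable (stepFun F v) :=
  Finset.stronglyMeasurable_fun_sum F fun R hR => stronglyMeasurable_const.indicator (hF R hR)

theorem lintegral_stepFun (hF : ∀ R ∈ F, MeasurableSet R) (v : Set Ω → ℝ≥0∞) :
    ∫⁻ x, stepFun F v x ∂m = ∑ R ∈ F, v R * m R := by
  simp only [stepFun]
  rw [lintegral_finsetSum F fun R hR => measurable_const.indicator (hF R hR)]
  exact Finset.sum_congr rfl fun R hR => lintegral_indicator_const (hF R hR) _

theorem eLpNorm_stepFun (hF : ∀ R ∈ F, MeasurableSet R)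
    (hd : ∀ Q ∈ F, ∀ R ∈ F, Q ≠ R → Disjoint Q R) {p : ℝ} (hp : 0 < p) (v : Set Ω → ℝ≥0∞) :
    eLpNorm (stepFun F v) (ENNReal.ofReal p) m = lpSum p F fun R => m R ^ (1 / p) * v R := by
  rw [eLpNorm_eq_lintegral_rpow_enorm_toReal (by simpa using hp) ENNReal.ofReal_ne_top,
    ENNReal.toReal_ofReal hp.le]
  simp only [enorm_eq_self, stepFun_rpow hd hp, lintegral_stepFun hF, lpSum]
  congr 1
  refine Finset.sum_congr rfl fun R _ => ?_
  rw [ENNReal.mul_rpow_of_nonneg _ _ hp.le, one_div, ENNReal.rpow_inv_rpow hp.ne', mul_comm]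

end StepFunctions

section Layers

variable {Ω : Type*} [MeasurableSpace Ω] {m : Measure Ω} {P : ℕ → Finset (Set Ω)} {κ θ : ℝ≥0∞}

namespace IsRefiningGrid

theorem eLpNorm_le_lpSum [IsFiniteMeasure m] (h : IsRefiningGrid m P κ θ) {p s : ℝ} (hp : 0 < p)
    (hs : 0 ≤ s) {k : ℕ} {f : Ω → ℂ} {v : Set Ω → ℝ≥0∞}
    (hf : ∀ R ∈ P k, ∀ᵐ x ∂m, x ∈ R → ‖f x‖ₑ ≤ v R) :
    eLpNorm f (ENNReal.ofReal p) m ≤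
      m Set.univ ^ s * ((θ ^ s) ^ k * lpSum p (P k) fun R => m R ^ (1 / p - s) * v R) := by
  have hstep : ∀ᵐ x ∂m, ‖f x‖ₑ ≤ ‖stepFun (P k) v x‖ₑ := by
    filter_upwards [h.cover k, (ae_ball_iff (P k).countable_toSet).2 hf] with x ⟨R, hR, hx⟩ hfx
    rw [stepFun_apply (h.disjoint k) hR hx]
    exact hfx R hR hx
  calc eLpNorm f (ENNReal.ofReal p) m
      ≤ eLpNorm (stepFun (P k) v) (ENNReal.ofReal p) m := eLpNorm_mono_enorm_ae hstep
    _ = lpSum p (P k) fun R => m R ^ (1 / p) * v R :=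
        eLpNorm_stepFun (h.measurable k) (h.disjoint k) hp v
    _ ≤ lpSum p (P k) fun R => (θ ^ k * m Set.univ) ^ s * (m R ^ (1 / p - s) * v R) := by
        refine lpSum_mono hp.le fun R hR => ?_
        rw [← mul_assoc, ← add_sub_cancel s (1 / p),
          ENNReal.rpow_add _ _ (h.pos k R hR).ne' (measure_ne_top m R), add_sub_cancel]
        gcongr
        exact h.measure_le_pow hR
    _ = _ := by
        rw [lpSum_const_mul hp, ENNReal.mul_rpow_of_nonneg _ _ hs, pow_rpow_comm, mul_assoc,
          mul_left_comm]

theorem lpSum_lpSum_descendants (h : IsRefiningGrid m P κ θ) {p : ℝ} (hp : 0 < p) {j k : ℕ}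
    (hjk : j ≤ k) (f : Set Ω → ℝ≥0∞) :
    lpSum p (P j) (fun Q => lpSum p (descendants P k Q) f) = lpSum p (P k) f := by
  rw [lpSum, lpSum, h.sum_eq_sum_descendants hjk]
  simp only [lpSum_rpow hp]

theorem lpSum_parent_le [IsFiniteMeasure m] (h : IsRefiningGrid m P κ θ) {p : ℝ} (hp : 0 < p)
    (k : ℕ) (f : Set Ω → ℝ≥0∞) :
    lpSum p (P (k + 1)) (fun R => f (ancestor P k R)) ≤ κ⁻¹ ^ (1 / p) * lpSum p (P k) f := by
  rw [lpSum, lpSum, ← ENNReal.mul_rpow_of_nonneg _ _ (by positivity)]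
  gcongr
  exact h.sum_parent_le k fun Q => f Q ^ p

theorem sum_level_mul_apply (h : IsRefiningGrid m P κ θ) {c : Set Ω → ℂ} {a : Set Ω → Ω → ℂ}
    {j k : ℕ} (ha : ∀ Q ∈ P j, ∀ x ∉ Q, a Q x = 0) (hjk : j ≤ k) {R : Set Ω} (hR : R ∈ P k) {x : Ω}
    (hx : x ∈ R) : ∑ Q ∈ P j, c Q * a Q x = c (ancestor P j R) * a (ancestor P j R) x := by
  refine Finset.sum_eq_single_of_mem _ (h.ancestor_mem hjk hR) fun Q hQ hne => ?_
  rw [ha Q hQ x fun hxQ => hne (h.ancestor_eq_of_mem hjk hR hQ hx hxQ).symm, mul_zero]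

end IsRefiningGrid

end Layers

section IntervalGrids

theorem finite_sdiff_interior {S : Set ℝ} (hS : S.OrdConnected) : (S \ interior S).Finite := by
  refine S.finite_sdiff_iUnion_Ioo.subset (Set.sdiff_subset_sdiff_right ?_)
  exact Set.iUnion₂_subset fun x hx => Set.iUnion₂_subset fun y hy =>
    interior_maximal (Set.Ioo_subset_Icc_self.trans (hS.out hx hy)) isOpen_Ioo

/-- A point in the interior of `R`, with the junk value `0` if the interior is empty. -/
def innerPt (R : Set ℝ) : ℝ :=
  open Classical in if h : (interior R).Nonempty then h.some else 0

variable {m : Measure ℝ} {P : ℕ → Finset (Set ℝ)} {κ θ : ℝ≥0∞}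

/-- A refining grid whose elements are intervals. -/
structure IsIntervalGrid (m : Measure ℝ) (P : ℕ → Finset (Set ℝ)) (κ θ : ℝ≥0∞) : Prop
    extends IsRefiningGrid m P κ θ where
  ordConnected : ∀ k, ∀ Q ∈ P k, Q.OrdConnected

namespace IsIntervalGrid

variable {j k : ℕ} {Q R : Set ℝ}

theorem induced (h : IsIntervalGrid m P κ θ) {k₀ : ℕ} (hQ : Q ∈ P k₀) :
    IsIntervalGrid (m.restrict Q) (inducedGrid P k₀ Q) κ θ where
  toIsRefiningGrid := h.toIsRefiningGrid.induced hQ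
  ordConnected _ R hR := h.ordConnected _ R (mem_inducedGrid.1 hR).1

variable [IsFiniteMeasure m]

theorem ae_mem_interior (h : IsIntervalGrid m P κ θ) (hR : R ∈ P k) :
    ∀ᵐ x ∂m, x ∈ R → x ∈ interior R := by
  have := h.nullSingletonClass
  filter_upwards [(finite_sdiff_interior (h.ordConnected k R hR)).countable.ae_notMem m]
    with x hx hxR
  exact by_contra fun hxi => hx ⟨hxR, hxi⟩

theorem ae_forall_mem_interior (h : IsIntervalGrid m P κ θ) :
    ∀ᵐ x ∂m, ∀ k, ∃ R ∈ P k, x ∈ interior R := by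
  refine ae_all_iff.2 fun k => ?_
  filter_upwards [h.cover k, (ae_ball_iff (P k).countable_toSet).2 fun R => h.ae_mem_interior]
    with x ⟨R, hR, hx⟩ hint
  exact ⟨R, hR, hint R hR hx⟩

theorem measure_interior (h : IsIntervalGrid m P κ θ) (hR : R ∈ P k) : m (interior R) = m R :=
  measure_congr <| (h.ae_mem_interior hR).mono fun _ hx =>
    propext ⟨fun hi => interior_subset hi, hx⟩

theorem interior_nonempty (h : IsIntervalGrid m P κ θ) (hR : R ∈ P k) : (interior R).Nonempty :=
  nonempty_of_measure_ne_zero (h.measure_interior hR ▸ (h.pos k R hR).ne')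

theorem innerPt_mem_interior (h : IsIntervalGrid m P κ θ) (hR : R ∈ P k) :
    innerPt R ∈ interior R := by
  rw [innerPt, dif_pos (h.interior_nonempty hR)]
  exact Set.Nonempty.some_mem _

theorem sum_powerVar_interior_rpow_le (h : IsIntervalGrid m P κ θ) {β : ℝ} (hβ : 0 < β)
    {a : ℝ → ℂ} {F : Finset (Set ℝ)} (hF : F ⊆ P k) {S : Set ℝ} (hS : ∀ R ∈ F, interior R ⊆ S) :
    ∑ R ∈ F, powerVar β a (interior R) ^ (1 / β) ≤ powerVar β a S ^ (1 / β) :=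
  sum_powerVar_rpow_le hβ (fun R hR => (h.ordConnected k R (hF hR)).interior)
    (fun _ hR => h.interior_nonempty (hF hR))
    (fun R hR R' hR' hne => (h.disjoint k R (hF hR) R' (hF hR') hne).mono
      interior_subset interior_subset) hS

theorem lpSum_descendants_critical_le (h : IsIntervalGrid m P κ θ) {p β : ℝ} (hp : 0 < p)
    (hβ : 0 < β) (hβp : β ≤ 1 / p) (k : ℕ) (Q : Set ℝ) (a : ℝ → ℂ) :
    lpSum p (descendants P k Q) (fun R => m R ^ (1 / p - β) * powerVar β a (interior R)) ≤
      m Q ^ (1 / p - β) * powerVar β a (interior Q) := by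
  set w : Set ℝ → ℝ≥0∞ := fun R => powerVar β a (interior R) ^ (1 / β)
  have hw (R : Set ℝ) : powerVar β a (interior R) = w R ^ β := by
    rw [← ENNReal.rpow_mul, one_div_mul_cancel hβ.ne', ENNReal.rpow_one]
  have hw_sum : ∑ R ∈ descendants P k Q, w R ≤ w Q :=
    h.sum_powerVar_interior_rpow_le hβ (fun R hR => (mem_descendants.1 hR).1)
      fun R hR => interior_mono (mem_descendants.1 hR).2
  simp only [hw]
  refine (lpSum_rpow_mul_rpow_le hp hβ.le hβp).trans ?_
  gcongr
  exact h.sum_descendants_measure_le k Q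

theorem lpSum_descendants_le (h : IsIntervalGrid m P κ θ) {p s β : ℝ} (hp : 0 < p)
    (hβ : 0 < β) (hsβ : s ≤ β) (hβp : β ≤ 1 / p) (hjk : j ≤ k) (hQ : Q ∈ P j) (a : ℝ → ℂ) :
    lpSum p (descendants P k Q) (fun R => m R ^ (1 / p - s) * powerVar β a (interior R)) ≤
      (θ ^ (β - s)) ^ (k - j) * (m Q ^ (1 / p - s) * powerVar β a (interior Q)) := by
  have hsplit {S : Set ℝ} {i : ℕ} (hS : S ∈ P i) :
      m S ^ (1 / p - s) = m S ^ (β - s) * m S ^ (1 / p - β) := by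
    rw [← ENNReal.rpow_add _ _ (h.pos i S hS).ne' (measure_ne_top m S)]
    ring_nf
  have hterm : ∀ R ∈ descendants P k Q, m R ^ (1 / p - s) * powerVar β a (interior R) ≤
      (θ ^ (k - j) * m Q) ^ (β - s) * (m R ^ (1 / p - β) * powerVar β a (interior R)) := by
    intro R hR
    obtain ⟨hR, hRQ⟩ := mem_descendants.1 hR
    rw [hsplit hR, mul_assoc]
    gcongr
    exact h.measure_le_pow_mul hjk hR hQ hRQ
  calc lpSum p (descendants P k Q) (fun R => m R ^ (1 / p - s) * powerVar β a (interior R))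
      ≤ (θ ^ (k - j) * m Q) ^ (β - s) * (m Q ^ (1 / p - β) * powerVar β a (interior Q)) := by
        refine (lpSum_mono hp.le hterm).trans ?_
        rw [lpSum_const_mul hp]
        gcongr
        exact h.lpSum_descendants_critical_le hp hβ hβp k Q a
    _ = (θ ^ (β - s)) ^ (k - j) * (m Q ^ (1 / p - s) * powerVar β a (interior Q)) := by
        rw [ENNReal.mul_rpow_of_nonneg _ _ (sub_nonneg.2 hsβ), pow_rpow_comm, hsplit hQ,
          mul_assoc, mul_assoc]

end IsIntervalGrid

end IntervalGrids

section Oscillation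

/-- A partial sum of the series of the level sums `∑_{Q ∈ Pᵏ} c_Q a_Q`. -/
def partialSum {Ω : Type*} (P : ℕ → Finset (Set Ω)) (c : Set Ω → ℂ) (a : Set Ω → Ω → ℂ) (n : ℕ)
    (x : Ω) : ℂ :=
  ∑ k ∈ Finset.range n, ∑ Q ∈ P k, c Q * a Q x

/-- The bound by power variation for the oscillation of the level sum `∑_{Q ∈ Pʲ} c_Q a_Q` on the
interior of an element `R` of a finer level. -/
def levelOsc (P : ℕ → Finset (Set ℝ)) (β : ℝ) (c : Set ℝ → ℂ) (a : Set ℝ → ℝ → ℂ) (j : ℕ)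
    (R : Set ℝ) : ℝ≥0∞ :=
  ‖c (ancestor P j R)‖ₑ * powerVar β (a (ancestor P j R)) (interior R)

theorem ofReal_real_rpow {Ω : Type*} [MeasurableSpace Ω] {m : Measure Ω} [IsFiniteMeasure m]
    {Q : Set Ω} (hQ : 0 < m Q) (r : ℝ) : ENNReal.ofReal (m.real Q ^ r) = m Q ^ r := by
  have hpos : 0 < m.real Q := ENNReal.toReal_pos hQ.ne' (measure_ne_top m Q)
  rw [← ENNReal.ofReal_rpow_of_pos hpos, ofReal_measureReal]

variable {m : Measure ℝ} {P : ℕ → Finset (Set ℝ)} {κ θ : ℝ≥0∞} {s β p : ℝ}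
  {c : Set ℝ → ℂ} {a : Set ℝ → ℝ → ℂ} {j k n : ℕ} {R : Set ℝ}

theorem rpow_mul_powerVar_le_one [IsFiniteMeasure m] {Q : Set ℝ} (hQ : 0 < m Q) {b : ℝ → ℂ}
    (hb : b ∈ bvAtoms m s β p Q) : m Q ^ (1 / p - s) * powerVar β b (interior Q) ≤ 1 := by
  calc m Q ^ (1 / p - s) * powerVar β b (interior Q)
      ≤ m Q ^ (1 / p - s) * m Q ^ (s - 1 / p) := by
        rw [← ofReal_real_rpow hQ (s - 1 / p)]
        gcongr
        exact hb.2.2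
    _ = 1 := by
        rw [← ENNReal.rpow_add _ _ hQ.ne' (measure_ne_top m Q)]
        simp

namespace IsIntervalGrid

theorem enorm_partialSum_sub_le (h : IsIntervalGrid m P κ θ) (hβ : 0 < β)
    (ha : ∀ i, ∀ Q ∈ P i, ∀ x ∉ Q, a Q x = 0) (hn : n ≤ k + 1) (hR : R ∈ P k) {x y : ℝ}
    (hx : x ∈ interior R) (hy : y ∈ interior R) :
    ‖partialSum P c a n x - partialSum P c a n y‖ₑ ≤
      ∑ j ∈ Finset.range n, levelOsc P β c a j R := by
  rw [partialSum, partialSum, ← Finset.sum_sub_distrib]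
  refine (enorm_sum_le _ _).trans (Finset.sum_le_sum fun j hj => ?_)
  have hjk : j ≤ k := Nat.le_of_lt_succ ((Finset.mem_range.1 hj).trans_le hn)
  rw [h.sum_level_mul_apply (ha j) hjk hR (interior_subset hx),
    h.sum_level_mul_apply (ha j) hjk hR (interior_subset hy), ← mul_sub, enorm_mul, levelOsc]
  gcongr
  exact enorm_sub_le_powerVar hβ hx hy

variable [IsFiniteMeasure m]

theorem lpSum_levelOsc_le (h : IsIntervalGrid m P κ θ) (hp : 0 < p) (hβ : 0 < β) (hsβ : s ≤ β)
    (hβp : β ≤ 1 / p) (ha : ∀ Q ∈ P j, a Q ∈ bvAtoms m s β p Q) (hjk : j ≤ k) :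
    lpSum p (P k) (fun R => m R ^ (1 / p - s) * levelOsc P β c a j R) ≤
      (θ ^ (β - s)) ^ (k - j) * levelCost p P c j := by
  rw [← h.lpSum_lpSum_descendants hp hjk, levelCost, ← lpSum_const_mul hp]
  refine lpSum_mono hp.le fun Q hQ => ?_
  calc lpSum p (descendants P k Q) (fun R => m R ^ (1 / p - s) * levelOsc P β c a j R)
      ≤ lpSum p (descendants P k Q)
          (fun R => ‖c Q‖ₑ * (m R ^ (1 / p - s) * powerVar β (a Q) (interior R))) := by
        refine lpSum_mono hp.le fun R hR => ?_
        obtain ⟨hR, hRQ⟩ := mem_descendants.1 hR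
        rw [levelOsc, h.ancestor_eq hjk hR hQ hRQ, mul_left_comm]
    _ ≤ ‖c Q‖ₑ * ((θ ^ (β - s)) ^ (k - j) *
          (m Q ^ (1 / p - s) * powerVar β (a Q) (interior Q))) := by
        rw [lpSum_const_mul hp]
        gcongr
        exact h.lpSum_descendants_le hp hβ hsβ hβp hjk hQ (a Q)
    _ ≤ ‖c Q‖ₑ * ((θ ^ (β - s)) ^ (k - j) * 1) := by
        gcongr
        exact rpow_mul_powerVar_le_one (h.pos j Q hQ) (ha Q hQ)
    _ = (θ ^ (β - s)) ^ (k - j) * ‖c Q‖ₑ := by rw [mul_one, mul_comm]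

theorem lpSum_levelOsc_parent_le (h : IsIntervalGrid m P κ θ) (hp : 0 < p) (hβ : 0 < β)
    (hsβ : s ≤ β) (hβp : β ≤ 1 / p) (ha : ∀ Q ∈ P j, a Q ∈ bvAtoms m s β p Q) (hjk : j ≤ k) :
    lpSum p (P (k + 1)) (fun R => m R ^ (1 / p - s) * levelOsc P β c a j (ancestor P k R)) ≤
      κ⁻¹ ^ (1 / p) * ((θ ^ (β - s)) ^ (k + 1 - j) * levelCost p P c j) := by
  have hterm : ∀ R ∈ P (k + 1),
      m R ^ (1 / p - s) * levelOsc P β c a j (ancestor P k R) ≤ θ ^ (β - s) *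
        (m (ancestor P k R) ^ (1 / p - s) * levelOsc P β c a j (ancestor P k R)) := by
    intro R hR
    have hmR : m R ≤ θ * m (ancestor P k R) :=
      h.upper k _ (h.ancestor_mem k.le_succ hR) R hR (h.subset_ancestor k.le_succ hR)
    have hθ : θ ^ (1 / p - s) ≤ θ ^ (β - s) :=
      ENNReal.rpow_le_rpow_of_exponent_ge h.θ_lt_one.le (by linarith)
    rw [← mul_assoc]
    gcongr
    calc m R ^ (1 / p - s) ≤ (θ * m (ancestor P k R)) ^ (1 / p - s) :=
          ENNReal.rpow_le_rpow hmR (by linarith)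
      _ ≤ θ ^ (β - s) * m (ancestor P k R) ^ (1 / p - s) := by
          rw [ENNReal.mul_rpow_of_nonneg _ _ (by linarith)]
          gcongr
  calc lpSum p (P (k + 1)) (fun R => m R ^ (1 / p - s) * levelOsc P β c a j (ancestor P k R))
      ≤ θ ^ (β - s) * (κ⁻¹ ^ (1 / p) *
          lpSum p (P k) fun Q => m Q ^ (1 / p - s) * levelOsc P β c a j Q) := by
        refine (lpSum_mono hp.le hterm).trans ?_
        rw [lpSum_const_mul hp]
        gcongr
        exact h.lpSum_parent_le hp k fun Q => m Q ^ (1 / p - s) * levelOsc P β c a j Q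
    _ ≤ θ ^ (β - s) * (κ⁻¹ ^ (1 / p) * ((θ ^ (β - s)) ^ (k - j) * levelCost p P c j)) := by
        gcongr
        exact h.lpSum_levelOsc_le hp hβ hsβ hβp ha hjk
    _ = _ := by
        rw [Nat.succ_sub hjk, pow_succ]
        ring

end IsIntervalGrid

end Oscillation

section SouzaExpansion

section Atoms

variable {Ω : Type*} [MeasurableSpace Ω] {m : Measure Ω} {s p : ℝ} {Q : Set Ω}

/-- The largest nonnegative `(s, p)`-Souza atom on `Q`. -/
def souzaAtom (m : Measure Ω) (s p : ℝ) (Q : Set Ω) : Ω → ℂ :=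
  Q.indicator fun _ => ((m.real Q ^ (s - 1 / p) : ℝ) : ℂ)

theorem souzaAtom_mem_souzaAtoms : souzaAtom m s p Q ∈ souzaAtoms m s p Q := by
  refine ⟨fun x hx => Set.indicator_of_notMem hx _, ⟨_, fun x hx => Set.indicator_of_mem hx _⟩, ?_⟩
  refine (eLpNorm_indicator_const_le _ _).trans ?_
  simp [← ofReal_norm, abs_of_nonneg, Real.rpow_nonneg]

theorem enorm_ofReal_real_rpow [IsFiniteMeasure m] (hQ : 0 < m Q) (r : ℝ) :
    ‖((m.real Q ^ r : ℝ) : ℂ)‖ₑ = m Q ^ r := by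
  rw [← ofReal_real_rpow hQ, ← ofReal_norm, Complex.norm_real, Real.norm_of_nonneg (by positivity)]

end Atoms

/-- The coefficient at `R` of the Souza expansion of `g = ∑ₖ ∑_{Q ∈ Pᵏ} c_Q a_Q`. It is chosen such
that the Souza layers up to level `k` add up, on `R ∈ Pᵏ`, to the value at `innerPt R` of the part
of the series of `g` up to level `k`. At level `0` the subtracted partial sum is empty. -/
def souzaCoeff (m : Measure ℝ) (P : ℕ → Finset (Set ℝ)) (s p : ℝ) (c : Set ℝ → ℂ)
    (a : Set ℝ → ℝ → ℂ) (R : Set ℝ) : ℂ :=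
  ((m.real R ^ (1 / p - s) : ℝ) : ℂ) *
    (partialSum P c a (level P R + 1) (innerPt R) -
      partialSum P c a (level P R) (innerPt (ancestor P (level P R - 1) R)))

variable {m : Measure ℝ} {P : ℕ → Finset (Set ℝ)} {κ θ : ℝ≥0∞} {s β p : ℝ}
  {c : Set ℝ → ℂ} {a : Set ℝ → ℝ → ℂ} {k n : ℕ} {R : Set ℝ}

theorem souzaAtoms_subset_bvAtoms (hβ : 0 < β) (Q : Set ℝ) :
    souzaAtoms m s p Q ⊆ bvAtoms m s β p Q := by
  rintro a ⟨hsupp, ⟨z, hz⟩, hb⟩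
  refine ⟨hsupp, hb, ?_⟩
  rw [powerVar_eq_zero_of_const hβ fun x hx => hz x (interior_subset hx)]
  exact zero_le

/-- The essential supremum bounds `b` only almost everywhere, hence the factor `2`. -/
theorem enorm_apply_le_of_mem_bvAtoms {Q : Set ℝ} (hQ : m (interior Q) ≠ 0) (hβ : 0 < β)
    {b : ℝ → ℂ} (hb : b ∈ bvAtoms m s β p Q) {x : ℝ} (hx : x ∈ interior Q) :
    ‖b x‖ₑ ≤ 2 * ENNReal.ofReal (m.real Q ^ (s - 1 / p)) := by
  obtain ⟨y, hy, hby⟩ : ∃ y ∈ interior Q, ‖b y‖ₑ ≤ eLpNorm b ∞ m := by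
    by_contra! hlt
    exact hQ (measure_mono_null (fun y hy => (hlt y hy).not_ge) (ae_le_eLpNormEssSup (f := b)))
  calc ‖b x‖ₑ = ‖b y + (b x - b y)‖ₑ := by rw [add_sub_cancel]
    _ ≤ ‖b y‖ₑ + ‖b x - b y‖ₑ := enorm_add_le _ _
    _ ≤ ENNReal.ofReal (m.real Q ^ (s - 1 / p)) + ENNReal.ofReal (m.real Q ^ (s - 1 / p)) :=
        add_le_add (hby.trans hb.2.1) ((enorm_sub_le_powerVar hβ hx hy).trans hb.2.2)
    _ = 2 * ENNReal.ofReal (m.real Q ^ (s - 1 / p)) := (two_mul _).symm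

namespace IsIntervalGrid

variable [IsFiniteMeasure m]

theorem rpow_mul_enorm_apply_le_two (h : IsIntervalGrid m P κ θ) (hβ : 0 < β) (hR : R ∈ P k)
    {b : ℝ → ℂ} (hb : b ∈ bvAtoms m s β p R) {x : ℝ} (hx : x ∈ interior R) :
    m R ^ (1 / p - s) * ‖b x‖ₑ ≤ 2 := by
  have hmR : m (interior R) ≠ 0 := h.measure_interior hR ▸ (h.pos k R hR).ne'
  calc m R ^ (1 / p - s) * ‖b x‖ₑ ≤ m R ^ (1 / p - s) * (2 * m R ^ (s - 1 / p)) := by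
        rw [← ofReal_real_rpow (h.pos k R hR) (s - 1 / p)]
        gcongr
        exact enorm_apply_le_of_mem_bvAtoms hmR hβ hb hx
    _ = 2 := by
        rw [mul_left_comm, ← ENNReal.rpow_add _ _ (h.pos k R hR).ne' (measure_ne_top m R)]
        simp

theorem enorm_souzaCoeff_le (h : IsIntervalGrid m P κ θ) (hβ : 0 < β)
    (ha : ∀ i, ∀ Q ∈ P i, a Q ∈ bvAtoms m s β p Q) (hR : R ∈ P k) :
    ‖souzaCoeff m P s p c a R‖ₑ ≤ 2 * ‖c R‖ₑ +
      ∑ j ∈ Finset.range k, m R ^ (1 / p - s) * levelOsc P β c a j (ancestor P (k - 1) R) := by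
  set S := ancestor P (k - 1) R
  have hS : S ∈ P (k - 1) := h.ancestor_mem (k.sub_le 1) hR
  have hRS : R ⊆ S := h.subset_ancestor (k.sub_le 1) hR
  have hξ : innerPt R ∈ interior R := h.innerPt_mem_interior hR
  have hlast : partialSum P c a (k + 1) (innerPt R) =
      partialSum P c a k (innerPt R) + c R * a R (innerPt R) := by
    rw [partialSum, Finset.sum_range_succ, h.sum_level_mul_apply (fun Q hQ => (ha k Q hQ).1) le_rfl
      hR (interior_subset hξ), h.ancestor_eq le_rfl hR hR subset_rfl, partialSum]
  have hosc : ‖partialSum P c a k (innerPt R) - partialSum P c a k (innerPt S)‖ₑ ≤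
      ∑ j ∈ Finset.range k, levelOsc P β c a j S :=
    h.enorm_partialSum_sub_le hβ (fun i Q hQ => (ha i Q hQ).1) le_tsub_add hS
      (interior_mono hRS hξ) (h.innerPt_mem_interior hS)
  rw [souzaCoeff, h.level_eq hR, hlast, enorm_mul, enorm_ofReal_real_rpow (h.pos k R hR),
    add_sub_right_comm, add_comm]
  calc m R ^ (1 / p - s) * ‖c R * a R (innerPt R) +
        (partialSum P c a k (innerPt R) - partialSum P c a k (innerPt S))‖ₑ
      ≤ m R ^ (1 / p - s) * (‖c R‖ₑ * ‖a R (innerPt R)‖ₑ +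
          ∑ j ∈ Finset.range k, levelOsc P β c a j S) := by
        rw [← enorm_mul]
        gcongr
        exact (enorm_add_le _ _).trans (add_le_add_right hosc _)
    _ ≤ _ := by
        rw [mul_add, Finset.mul_sum, mul_left_comm, mul_comm 2]
        gcongr
        exact h.rpow_mul_enorm_apply_le_two hβ hR (ha k R hR) hξ

theorem levelCost_souzaCoeff_le (h : IsIntervalGrid m P κ θ) (hp : 1 ≤ p) (hβ : 0 < β)
    (hsβ : s ≤ β) (hβp : β ≤ 1 / p) (ha : ∀ i, ∀ Q ∈ P i, a Q ∈ bvAtoms m s β p Q) (k : ℕ) :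
    levelCost p P (souzaCoeff m P s p c a) k ≤ (2 + κ⁻¹ ^ (1 / p)) *
      ∑ j ∈ Finset.range (k + 1), (θ ^ (β - s)) ^ (k - j) * levelCost p P c j := by
  have hp₀ : 0 < p := by linarith
  have hosc : ∀ j ∈ Finset.range k,
      lpSum p (P k) (fun R => m R ^ (1 / p - s) * levelOsc P β c a j (ancestor P (k - 1) R)) ≤
        κ⁻¹ ^ (1 / p) * ((θ ^ (β - s)) ^ (k - j) * levelCost p P c j) := by
    intro j hj
    obtain ⟨i, rfl⟩ := Nat.exists_eq_succ_of_ne_zero (Finset.mem_range.1 hj).ne_bot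
    exact h.lpSum_levelOsc_parent_le hp₀ hβ hsβ hβp (ha j)
      (Nat.le_of_lt_succ (Finset.mem_range.1 hj))
  calc levelCost p P (souzaCoeff m P s p c a) k
      ≤ 2 * levelCost p P c k + ∑ j ∈ Finset.range k, lpSum p (P k)
          (fun R => m R ^ (1 / p - s) * levelOsc P β c a j (ancestor P (k - 1) R)) := by
        refine (lpSum_mono hp₀.le fun R hR => h.enorm_souzaCoeff_le hβ ha hR).trans ?_
        refine (lpSum_add_le hp).trans ?_
        rw [lpSum_const_mul hp₀, levelCost]
        gcongr
        exact lpSum_sum_le hp _ _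
    _ ≤ (2 + κ⁻¹ ^ (1 / p)) * levelCost p P c k + (2 + κ⁻¹ ^ (1 / p)) *
          ∑ j ∈ Finset.range k, (θ ^ (β - s)) ^ (k - j) * levelCost p P c j := by
        refine add_le_add (mul_le_mul_left le_self_add _) ((Finset.sum_le_sum hosc).trans ?_)
        rw [← Finset.mul_sum]
        exact mul_le_mul_left le_add_self _
    _ = _ := by rw [Finset.sum_range_succ, Nat.sub_self, pow_zero, one_mul, mul_add, add_comm]

theorem souza_term_apply (h : IsIntervalGrid m P κ θ) (hk : k ≤ n) (hR : R ∈ P n) {x : ℝ}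
    (hx : x ∈ R) :
    ∑ Q ∈ P k, souzaCoeff m P s p c a Q * souzaAtom m s p Q x =
      partialSum P c a (k + 1) (innerPt (ancestor P k R)) -
        partialSum P c a k (innerPt (ancestor P (k - 1) R)) := by
  have hS : ancestor P k R ∈ P k := h.ancestor_mem hk hR
  have hpos : 0 < m.real (ancestor P k R) :=
    ENNReal.toReal_pos (h.pos k _ hS).ne' (measure_ne_top m _)
  rw [h.sum_level_mul_apply (a := souzaAtom m s p)
      (fun Q _ y hy => Set.indicator_of_notMem hy _) hk hR hx, souzaCoeff,
    souzaAtom, Set.indicator_of_mem (h.subset_ancestor hk hR hx), h.level_eq hS,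
    h.ancestor_ancestor (k.sub_le 1) hk hR, mul_right_comm, ← Complex.ofReal_mul,
    ← Real.rpow_add hpos]
  simp

theorem partialSum_souza_apply (h : IsIntervalGrid m P κ θ) (hR : R ∈ P n) {x : ℝ} (hx : x ∈ R) :
    partialSum P (souzaCoeff m P s p c a) (souzaAtom m s p) (n + 1) x =
      partialSum P c a (n + 1) (innerPt R) := by
  have htel := Finset.sum_range_sub
    (fun k => partialSum P c a k (innerPt (ancestor P (k - 1) R))) (n + 1)
  rw [partialSum, Finset.sum_congr rfl fun k hk =>
    h.souza_term_apply (Nat.le_of_lt_succ (Finset.mem_range.1 hk)) hR hx]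
  simpa [partialSum, h.ancestor_eq le_rfl hR hR subset_rfl] using htel

end IsIntervalGrid

end SouzaExpansion

section Measurability

variable {m : Measure ℝ} [IsFiniteMeasure m] {P : ℕ → Finset (Set ℝ)} {κ θ : ℝ≥0∞} {s β p : ℝ}

namespace IsIntervalGrid

theorem ae_tendsto_powerVar_interior (h : IsIntervalGrid m P κ θ) (hβ : 0 < β) {b : ℝ → ℂ}
    {S : Set ℝ} (hS : ∀ k, ∀ R ∈ P k, interior R ⊆ S) (hb : powerVar β b S ≠ ∞) :
    ∀ᵐ x ∂m, Tendsto (fun k => stepFun (P k) (fun R => powerVar β b (interior R) ^ (1 / β)) x)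
      atTop (𝓝 0) := by
  set w : Set ℝ → ℝ≥0∞ := fun R => powerVar β b (interior R) ^ (1 / β)
  have hmeas (k : ℕ) : Measurable (stepFun (P k) w) :=
    (stronglyMeasurable_stepFun (h.measurable k) w).measurable
  have hlevel (k : ℕ) : ∫⁻ x, stepFun (P k) w x ∂m ≤
      θ ^ k * (m Set.univ * powerVar β b S ^ (1 / β)) := by
    calc ∫⁻ x, stepFun (P k) w x ∂m = ∑ R ∈ P k, w R * m R := lintegral_stepFun (h.measurable k) w
      _ ≤ ∑ R ∈ P k, w R * (θ ^ k * m Set.univ) := by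
          gcongr with R hR
          exact h.measure_le_pow hR
      _ ≤ powerVar β b S ^ (1 / β) * (θ ^ k * m Set.univ) := by
          rw [← Finset.sum_mul]
          gcongr
          exact h.sum_powerVar_interior_rpow_le hβ subset_rfl (hS k)
      _ = θ ^ k * (m Set.univ * powerVar β b S ^ (1 / β)) := by ring
  have hsum : ∫⁻ x, ∑' k, stepFun (P k) w x ∂m ≠ ∞ := by
    rw [lintegral_tsum fun k => (hmeas k).aemeasurable]
    refine ne_top_of_le_ne_top ?_ (ENNReal.tsum_le_tsum hlevel)
    rw [ENNReal.tsum_mul_right, ENNReal.tsum_geometric]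
    exact ENNReal.mul_ne_top (ENNReal.inv_ne_top.2 (tsub_pos_of_lt h.θ_lt_one).ne')
      (ENNReal.mul_ne_top (measure_ne_top m _) (ENNReal.rpow_ne_top_of_nonneg (by positivity) hb))
  filter_upwards [ae_lt_top (Measurable.tsum hmeas) hsum] with x hx
  exact ENNReal.tendsto_atTop_zero_of_tsum_ne_top hx.ne

theorem aestronglyMeasurable_of_powerVar_ne_top (h : IsIntervalGrid m P κ θ) (hβ : 0 < β)
    {b : ℝ → ℂ} {S : Set ℝ} (hS : ∀ k, ∀ R ∈ P k, interior R ⊆ S) (hb : powerVar β b S ≠ ∞) :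
    AEStronglyMeasurable b m := by
  refine aestronglyMeasurable_of_tendsto_ae atTop
    (f := fun k => stepFun (P k) fun R => b (innerPt R))
    (fun k => (stronglyMeasurable_stepFun (h.measurable k) _).aestronglyMeasurable) ?_
  filter_upwards [h.ae_tendsto_powerVar_interior hβ hS hb, h.ae_forall_mem_interior] with x hx hmem
  have hosc : Tendsto
      (fun k => stepFun (P k) (fun R => powerVar β b (interior R) ^ (1 / β)) x ^ β)
        atTop (𝓝 0) := by
    simpa [hβ] using hx.ennrpow_const β
  refine tendsto_iff_edist_tendsto_0.2 (tendsto_of_tendsto_of_tendsto_of_le_of_le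
    tendsto_const_nhds hosc (fun _ => zero_le) fun k => ?_)
  obtain ⟨R, hR, hxR⟩ := hmem k
  beta_reduce
  rw [stepFun_apply (h.disjoint k) hR (interior_subset hxR),
    stepFun_apply (h.disjoint k) hR (interior_subset hxR), ← ENNReal.rpow_mul,
    one_div_mul_cancel hβ.ne', ENNReal.rpow_one, edist_eq_enorm_sub]
  exact enorm_sub_le_powerVar hβ (h.innerPt_mem_interior hR) hxR

theorem aestronglyMeasurable_of_mem_bvAtoms (h : IsIntervalGrid m P κ θ) (hβ : 0 < β) {k : ℕ}
    {Q : Set ℝ} (hQ : Q ∈ P k) {b : ℝ → ℂ} (hb : b ∈ bvAtoms m s β p Q) :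
    AEStronglyMeasurable b m := by
  have hrestrict : AEStronglyMeasurable b (m.restrict Q) :=
    (h.induced hQ).aestronglyMeasurable_of_powerVar_ne_top hβ
      (fun _ R hR => interior_mono (mem_inducedGrid.1 hR).2)
      (ne_top_of_le_ne_top ENNReal.ofReal_ne_top hb.2.2)
  have hsupp : Q.indicator b = b :=
    Set.indicator_eq_self.2 fun x hx => by_contra fun hxQ => hx (hb.1 x hxQ)
  rw [← hsupp]
  exact (aestronglyMeasurable_indicator_iff (h.measurable k Q hQ)).2 hrestrict

theorem aestronglyMeasurable_partialSum (h : IsIntervalGrid m P κ θ) (hβ : 0 < β)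
    {c : Set ℝ → ℂ} {a : Set ℝ → ℝ → ℂ} (ha : ∀ i, ∀ Q ∈ P i, a Q ∈ bvAtoms m s β p Q) (n : ℕ) :
    AEStronglyMeasurable (partialSum P c a n) m :=
  Finset.aestronglyMeasurable_fun_sum _ fun i _ => Finset.aestronglyMeasurable_fun_sum _
    fun Q hQ => (h.aestronglyMeasurable_of_mem_bvAtoms hβ hQ (ha i Q hQ)).const_mul (c Q)

end IsIntervalGrid

end Measurability

section SouzaRepresentations

variable {κ θ q : ℝ≥0∞} {s β p : ℝ}

namespace IsRefiningGrid

variable {Ω : Type*} [MeasurableSpace Ω] {m : Measure Ω} {P : ℕ → Finset (Set Ω)}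

theorem tsum_pow_mul_levelCost_lt_top (h : IsRefiningGrid m P κ θ) (hs : 0 < s) (hq : q ≠ 0)
    {c : Set Ω → ℂ} (hc : cost p q P c < ∞) : ∑' k, (θ ^ s) ^ k * levelCost p P c k < ∞ := by
  calc ∑' k, (θ ^ s) ^ k * levelCost p P c k ≤ ∑' k, (θ ^ s) ^ k * cost p q P c := by
        gcongr with k
        exact levelCost_le_cost hq k
    _ < ∞ := by
        rw [ENNReal.tsum_mul_right, ENNReal.tsum_geometric]
        exact ENNReal.mul_lt_top (ENNReal.inv_lt_top.2
          (tsub_pos_of_lt (ENNReal.rpow_lt_one h.θ_lt_one hs))) hc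

theorem eLpNorm_souzaLayer_le [IsFiniteMeasure m] (h : IsRefiningGrid m P κ θ) (hp : 0 < p)
    (hs : 0 ≤ s) (e : Set Ω → ℂ) (k : ℕ) :
    eLpNorm (fun x => ∑ R ∈ P k, e R * souzaAtom m s p R x) (ENNReal.ofReal p) m ≤
      m Set.univ ^ s * ((θ ^ s) ^ k * levelCost p P e k) := by
  have hlayer : ∀ R ∈ P k, ∀ᵐ x ∂m, x ∈ R →
      ‖∑ S ∈ P k, e S * souzaAtom m s p S x‖ₑ ≤ ‖e R‖ₑ * m R ^ (s - 1 / p) := by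
    refine fun R hR => ae_of_all m fun x hx => ?_
    rw [h.sum_level_mul_apply (a := souzaAtom m s p)
      (fun S _ y hy => Set.indicator_of_notMem hy _) le_rfl hR hx, h.ancestor_eq le_rfl hR hR
      subset_rfl, souzaAtom, Set.indicator_of_mem hx, enorm_mul,
      enorm_ofReal_real_rpow (h.pos k R hR)]
  refine (h.eLpNorm_le_lpSum hp hs hlayer).trans ?_
  rw [levelCost]
  gcongr
  refine lpSum_mono hp.le fun R hR => ?_
  rw [mul_left_comm, ← ENNReal.rpow_add _ _ (h.pos k R hR).ne' (measure_ne_top m R)]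
  simp

end IsRefiningGrid

variable {m : Measure ℝ} [IsFiniteMeasure m] {P : ℕ → Finset (Set ℝ)} {c : Set ℝ → ℂ}
  {a : Set ℝ → ℝ → ℂ}

namespace IsIntervalGrid

theorem eLpNorm_partialSum_sub_souza_le (h : IsIntervalGrid m P κ θ) (hp : 1 ≤ p) (hs : 0 < s)
    (hsβ : s ≤ β) (hβp : β ≤ 1 / p) (ha : ∀ i, ∀ Q ∈ P i, a Q ∈ bvAtoms m s β p Q) (n : ℕ) :
    eLpNorm (fun x => partialSum P c a (n + 1) x -
        partialSum P (souzaCoeff m P s p c a) (souzaAtom m s p) (n + 1) x) (ENNReal.ofReal p) m ≤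
      m Set.univ ^ s *
        ∑ j ∈ Finset.range (n + 1), (θ ^ s) ^ (n - j) * ((θ ^ s) ^ j * levelCost p P c j) := by
  have hp₀ : 0 < p := by linarith
  have hβ : 0 < β := hs.trans_le hsβ
  have hdiff : ∀ R ∈ P n, ∀ᵐ x ∂m, x ∈ R →
      ‖partialSum P c a (n + 1) x -
        partialSum P (souzaCoeff m P s p c a) (souzaAtom m s p) (n + 1) x‖ₑ ≤
        ∑ j ∈ Finset.range (n + 1), levelOsc P β c a j R := by
    intro R hR
    filter_upwards [h.ae_mem_interior hR] with x hint hx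
    rw [h.partialSum_souza_apply hR hx]
    exact h.enorm_partialSum_sub_le hβ (fun i Q hQ => (ha i Q hQ).1) le_rfl hR (hint hx)
      (h.innerPt_mem_interior hR)
  have hlevel : ∀ j ∈ Finset.range (n + 1),
      lpSum p (P n) (fun R => m R ^ (1 / p - s) * levelOsc P β c a j R) ≤ levelCost p P c j := by
    intro j hj
    refine (h.lpSum_levelOsc_le hp₀ hβ hsβ hβp (ha j)
      (Nat.le_of_lt_succ (Finset.mem_range.1 hj))).trans (mul_le_of_le_one_left zero_le ?_)
    exact pow_le_one₀ zero_le (ENNReal.rpow_le_one h.θ_lt_one.le (sub_nonneg.2 hsβ))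
  refine (h.eLpNorm_le_lpSum hp₀ hs.le hdiff).trans ?_
  gcongr
  simp only [Finset.mul_sum]
  calc (θ ^ s) ^ n * lpSum p (P n)
          (fun R => ∑ j ∈ Finset.range (n + 1), m R ^ (1 / p - s) * levelOsc P β c a j R)
      ≤ (θ ^ s) ^ n * ∑ j ∈ Finset.range (n + 1), levelCost p P c j := by
        gcongr
        exact (lpSum_sum_le hp _ _).trans (Finset.sum_le_sum hlevel)
    _ = ∑ j ∈ Finset.range (n + 1), (θ ^ s) ^ (n - j) * ((θ ^ s) ^ j * levelCost p P c j) := by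
        rw [Finset.mul_sum]
        refine Finset.sum_congr rfl fun j hj => ?_
        rw [← mul_assoc, pow_sub_mul_pow _ (Nat.le_of_lt_succ (Finset.mem_range.1 hj))]

theorem tendsto_eLpNorm_partialSum_sub_souza (h : IsIntervalGrid m P κ θ) (hp : 1 ≤ p)
    (hs : 0 < s) (hsβ : s ≤ β) (hβp : β ≤ 1 / p)
    (ha : ∀ i, ∀ Q ∈ P i, a Q ∈ bvAtoms m s β p Q) (hq : q ≠ 0) (hc : cost p q P c < ∞) :
    Tendsto (fun n => eLpNorm (fun x => partialSum P c a n x -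
      partialSum P (souzaCoeff m P s p c a) (souzaAtom m s p) n x) (ENNReal.ofReal p) m)
      atTop (𝓝 0) := by
  rw [← tendsto_add_atTop_iff_nat 1]
  refine ENNReal.tendsto_atTop_zero_of_tsum_ne_top (ne_top_of_le_ne_top ?_
    (ENNReal.tsum_le_tsum (h.eLpNorm_partialSum_sub_souza_le hp hs hsβ hβp ha)))
  rw [ENNReal.tsum_mul_left, tsum_sum_range_pow_mul]
  exact ENNReal.mul_ne_top (ENNReal.rpow_ne_top_of_nonneg hs.le (measure_ne_top m _))
    (ENNReal.mul_ne_top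
      (ENNReal.inv_ne_top.2 (tsub_pos_of_lt (ENNReal.rpow_lt_one h.θ_lt_one hs)).ne')
      (h.tsum_pow_mul_levelCost_lt_top hs hq hc).ne)

theorem isRepresentation_souza (h : IsIntervalGrid m P κ θ) (hp : 1 ≤ p) (hs : 0 < s)
    (hsβ : s ≤ β) (hβp : β ≤ 1 / p) (hq : q ≠ 0) {g : ℝ → ℂ} (hg : AEStronglyMeasurable g m)
    (hrep : IsRepresentation m P (bvAtoms m s β p) p q g c a)
    (hcost : cost p q P (souzaCoeff m P s p c a) < ∞) :
    IsRepresentation m P (souzaAtoms m s p) p q g (souzaCoeff m P s p c a) (souzaAtom m s p) where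
  atom _ _ _ := souzaAtom_mem_souzaAtoms
  cost_lt := hcost
  abs_conv := by
    simp only [max_eq_left hp, div_self (one_pos.trans_le hp).ne', ENNReal.rpow_one]
    refine (ENNReal.tsum_le_tsum
      (h.eLpNorm_souzaLayer_le (by linarith) hs.le (souzaCoeff m P s p c a))).trans_lt ?_
    rw [ENNReal.tsum_mul_left]
    exact ENNReal.mul_lt_top (ENNReal.rpow_lt_top_of_nonneg hs.le (measure_ne_top m _))
      (h.tsum_pow_mul_levelCost_lt_top hs hq hcost)
  tendsto := by
    have hlim := hrep.tendsto.add
      (h.tendsto_eLpNorm_partialSum_sub_souza hp hs hsβ hβp hrep.atom hq hrep.cost_lt)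
    rw [add_zero] at hlim
    refine tendsto_of_tendsto_of_tendsto_of_le_of_le tendsto_const_nhds hlim (fun _ => zero_le)
      fun n => ?_
    have hbv : AEStronglyMeasurable (partialSum P c a n) m :=
      h.aestronglyMeasurable_partialSum (hs.trans_le hsβ) hrep.atom n
    have hsouza :
        AEStronglyMeasurable (partialSum P (souzaCoeff m P s p c a) (souzaAtom m s p) n) m :=
      h.aestronglyMeasurable_partialSum one_pos
        (fun _ Q _ => souzaAtoms_subset_bvAtoms one_pos Q souzaAtom_mem_souzaAtoms) n
    have htri := eLpNorm_add_le (hg.sub hbv) (hbv.sub hsouza) (p := ENNReal.ofReal p)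
      (by simpa using hp)
    rwa [sub_add_sub_cancel] at htri

end IsIntervalGrid

end SouzaRepresentations

section SingleAtoms

section

variable {Ω : Type*} [MeasurableSpace Ω] {m : Measure Ω} {P : ℕ → Finset (Set Ω)}
  {A : Set Ω → Set (Ω → ℂ)} {p : ℝ} {q κ θ : ℝ≥0∞} {Q : Set Ω}

theorem besovNorm_le_cost {g : Ω → ℂ} {c : Set Ω → ℂ} {a : Set Ω → Ω → ℂ}
    (h : IsRepresentation m P A p q g c a) : besovNorm m P A p q g ≤ cost p q P c :=
  iInf₂_le_of_le c a (iInf_le _ h)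

namespace IsRefiningGrid

theorem two_add_inv_rpow_ne_top (h : IsRefiningGrid m P κ θ) {r : ℝ} (hr : 0 ≤ r) :
    2 + κ⁻¹ ^ r ≠ ∞ :=
  ENNReal.add_ne_top.2 ⟨ENNReal.ofNat_ne_top,
    ENNReal.rpow_ne_top_of_nonneg hr (ENNReal.inv_ne_top.2 h.κ_ne_zero)⟩

variable [IsFiniteMeasure m]

theorem sum_level_eq_single (h : IsRefiningGrid m P κ θ) (hQ : P 0 = {Q}) {E : Type*}
    [AddCommMonoid E] {f : Set Ω → E} (hf : ∀ R, R ≠ Q → f R = 0) (k : ℕ) :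
    ∑ R ∈ P k, f R = (Pi.single 0 (f Q) : ℕ → E) k := by
  have hQ₀ : Q ∈ P 0 := hQ ▸ Finset.mem_singleton_self Q
  cases k with
  | zero => rw [hQ, Finset.sum_singleton, Pi.single_eq_same]
  | succ k =>
    rw [Pi.single_eq_of_ne k.succ_ne_zero]
    refine Finset.sum_eq_zero fun R hR => hf R ?_
    rintro rfl
    exact k.succ_ne_zero (h.level_unique hR hQ₀)

open Classical in
theorem levelCost_single (h : IsRefiningGrid m P κ θ) (hQ : P 0 = {Q}) (hp : 0 < p) (z : ℂ) :
    levelCost p P (Pi.single Q z) = Pi.single 0 ‖z‖ₑ := by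
  funext k
  rw [levelCost, lpSum, h.sum_level_eq_single hQ fun R hR => by simp [hR, hp]]
  obtain rfl | hk := eq_or_ne k 0
  · simp [hp.ne']
  · simp [hk, hp]

open Classical in
theorem sum_level_single_mul (h : IsRefiningGrid m P κ θ) (hQ : P 0 = {Q}) (z : ℂ) (b : Ω → ℂ)
    (k : ℕ) (x : Ω) :
    ∑ R ∈ P k, (Pi.single Q z : Set Ω → ℂ) R * (Pi.single Q b : Set Ω → Ω → ℂ) R x =
      (Pi.single 0 (z * b x) : ℕ → ℂ) k := by
  rw [h.sum_level_eq_single hQ fun R hR => by simp [hR]]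
  simp

open Classical in
theorem isRepresentation_single (h : IsRefiningGrid m P κ θ) (hQ : P 0 = {Q}) (hp : 1 ≤ p)
    (hq : q ≠ 0) (hA : ∀ R, 0 ∈ A R) {b : Ω → ℂ} (hb : b ∈ A Q)
    (hbp : eLpNorm b (ENNReal.ofReal p) m < ∞) (z : ℂ) :
    IsRepresentation m P A p q (fun x => z * b x) (Pi.single Q z) (Pi.single Q b) where
  atom k R _ := by
    obtain rfl | hR := eq_or_ne R Q
    · simpa using hb
    · simpa [hR] using hA R
  cost_lt := by
    rw [cost_eq_eLpNorm hq, h.levelCost_single hQ (by linarith)]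
    exact (eLpNorm_count_single_le hq _).trans_lt enorm_lt_top
  abs_conv := by
    have hp₀ : 0 < p := by linarith
    simp only [max_eq_left hp, div_self hp₀.ne', ENNReal.rpow_one, h.sum_level_single_mul hQ]
    rw [tsum_eq_single 0 fun k hk => by simp [hk]]
    simp only [Pi.single_eq_same]
    exact (eLpNorm_const_smul_le (c := z) (f := b)).trans_lt (ENNReal.mul_lt_top enorm_lt_top hbp)
  tendsto := by
    rw [← tendsto_add_atTop_iff_nat 1]
    simp [h.sum_level_single_mul hQ]

end IsRefiningGrid

end

variable {m : Measure ℝ} {P : ℕ → Finset (Set ℝ)} {p s β β' : ℝ} {q κ θ : ℝ≥0∞} {Q : Set ℝ}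

theorem zero_mem_bvAtoms (hβ : 0 < β) (R : Set ℝ) : 0 ∈ bvAtoms m s β p R :=
  souzaAtoms_subset_bvAtoms hβ R ⟨fun _ _ => rfl, ⟨0, fun _ _ => rfl⟩, by simp⟩

theorem const_mul_mem_bvAtoms {t : ℝ} (hβ : 0 < β) {z : ℂ}
    (hz : ‖z‖ₑ * ENNReal.ofReal (m.real Q ^ (s - 1 / p)) ≤ ENNReal.ofReal (m.real Q ^ (t - 1 / p)))
    {b : ℝ → ℂ} (hb : b ∈ bvAtoms m s β p Q) : (fun x => z * b x) ∈ bvAtoms m t β p Q := by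
  refine ⟨fun x hx => by simp [hb.1 x hx], le_trans ?_ hz, le_trans ?_ hz⟩
  · exact (eLpNorm_const_smul_le (c := z) (f := b)).trans (mul_le_mul_right hb.2.1 _)
  · exact (powerVar_const_mul_le hβ z).trans (mul_le_mul_right hb.2.2 _)

theorem rpow_mul_mem_bvAtoms [IsFiniteMeasure m] {t : ℝ} (hβ : 0 < β) (hQ : 0 < m Q) {b : ℝ → ℂ}
    (hb : b ∈ bvAtoms m s β p Q) :
    (fun x => ((m.real Q ^ (t - s) : ℝ) : ℂ) * b x) ∈ bvAtoms m t β p Q := by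
  refine const_mul_mem_bvAtoms hβ (le_of_eq ?_) hb
  rw [enorm_ofReal_real_rpow hQ, ofReal_real_rpow hQ, ofReal_real_rpow hQ,
    ← ENNReal.rpow_add _ _ hQ.ne' (measure_ne_top m Q), sub_add_sub_cancel]

theorem bvAtoms_subset_bvAtoms_restrict : bvAtoms m s β p Q ⊆ bvAtoms (m.restrict Q) s β p Q := by
  have hQ : (m.restrict Q).real Q = m.real Q := measureReal_restrict_apply_self Q
  rintro b ⟨hsupp, hbound, hvar⟩
  rw [← hQ] at hbound hvar
  exact ⟨hsupp, (eLpNorm_mono_measure b Measure.restrict_le_self).trans hbound, hvar⟩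

namespace IsIntervalGrid

variable [IsFiniteMeasure m]

theorem memLp_of_mem_bvAtoms (h : IsIntervalGrid m P κ θ) (hβ : 0 < β) {k : ℕ} (hQ : Q ∈ P k)
    {b : ℝ → ℂ} (hb : b ∈ bvAtoms m s β p Q) (r : ℝ≥0∞) : MemLp b r m := by
  have htop : MemLp b ∞ m :=
    ⟨h.aestronglyMeasurable_of_mem_bvAtoms hβ hQ hb, hb.2.1.trans_lt ENNReal.ofReal_lt_top⟩
  exact htop.mono_exponent le_top

open Classical in
theorem cost_souzaCoeff_single_le (h : IsIntervalGrid m P κ θ) (hQ : P 0 = {Q}) (hp : 1 ≤ p)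
    (hβ : 0 < β) (hsβ : s ≤ β) (hβp : β ≤ 1 / p) (hq : q ≠ 0) {z : ℂ} {a : Set ℝ → ℝ → ℂ}
    (ha : ∀ i, ∀ R ∈ P i, a R ∈ bvAtoms m s β p R) :
    cost p q P (souzaCoeff m P s p (Pi.single Q z) a) ≤ (2 + κ⁻¹ ^ (1 / p)) * ‖z‖ₑ *
      eLpNorm (fun k => (θ ^ (β - s)) ^ k) q Measure.count := by
  refine cost_le_of_levelCost_le hq fun k => ?_
  refine (h.levelCost_souzaCoeff_le hp hβ hsβ hβp ha k).trans_eq ?_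
  rw [h.levelCost_single hQ (by linarith),
    Finset.sum_eq_single_of_mem 0 (by simp) fun j _ hj => by simp [hj]]
  simp only [tsub_zero, Pi.single_eq_same]
  ring

theorem exists_souza_representation_of_mem_bvAtoms (h : IsIntervalGrid m P κ θ)
    (hQ : P 0 = {Q}) (hp : 1 ≤ p) (hs : 0 < s) (hsβ : s ≤ β) (hβp : β ≤ 1 / p) (hq : q ≠ 0)
    (hgeom : eLpNorm (fun k => (θ ^ (β - s)) ^ k) q Measure.count ≠ ∞) {b : ℝ → ℂ}
    (hb : b ∈ bvAtoms m s β p Q) (z : ℂ) :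
    ∃ e a, IsRepresentation m P (souzaAtoms m s p) p q (fun x => z * b x) e a ∧
      cost p q P e ≤ (2 + κ⁻¹ ^ (1 / p)) * ‖z‖ₑ *
        eLpNorm (fun k => (θ ^ (β - s)) ^ k) q Measure.count := by
  classical
  have hβ : 0 < β := hs.trans_le hsβ
  have hbLp := h.memLp_of_mem_bvAtoms hβ (hQ ▸ Finset.mem_singleton_self Q) hb (ENNReal.ofReal p)
  have hrep := h.isRepresentation_single hQ hp hq (zero_mem_bvAtoms hβ) hb hbLp.2 z
  have hcost := h.cost_souzaCoeff_single_le hQ hp hβ hsβ hβp hq (z := z) hrep.atom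
  refine ⟨_, _, h.isRepresentation_souza hp hs hsβ hβp hq (hbLp.1.const_mul z) hrep
    (hcost.trans_lt ?_), hcost⟩
  exact ENNReal.mul_lt_top (ENNReal.mul_lt_top
    (h.two_add_inv_rpow_ne_top (hβ.le.trans hβp)).lt_top enorm_lt_top) hgeom.lt_top

theorem mem_besovAtoms (h : IsIntervalGrid m P κ θ) (hp : 1 ≤ p) (hβ : 0 < β) (hββ' : β ≤ β')
    (hβp : β' ≤ 1 / p) (hq : q ≠ 0) {c₂ : ℝ}
    (hgeom : eLpNorm (fun k => (θ ^ (β' - β)) ^ k) q Measure.count ≠ ∞) {z : ℂ}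
    (hz : (2 + κ⁻¹ ^ (1 / p)) * ‖z‖ₑ * eLpNorm (fun k => (θ ^ (β' - β)) ^ k) q Measure.count ≤
      (besovAtomConst P c₂ β p q)⁻¹)
    {k : ℕ} (hQ : Q ∈ P k) {b : ℝ → ℂ} (hb : b ∈ bvAtoms m s β' p Q) :
    (fun x => z * b x) ∈ besovAtoms m P c₂ s β p q Q := by
  have hβ' : 0 < β' := hβ.trans_le hββ'
  have hrestrict : (m.restrict Q).real Q = m.real Q := measureReal_restrict_apply_self Q
  have hpos : 0 < m.real Q := ENNReal.toReal_pos (h.pos k Q hQ).ne' (measure_ne_top m Q)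
  have hscaled := rpow_mul_mem_bvAtoms (t := β) hβ'
    ((m.restrict_apply_self Q).symm ▸ h.pos k Q hQ) (bvAtoms_subset_bvAtoms_restrict hb)
  have hbLp := (h.memLp_of_mem_bvAtoms hβ' hQ hb (ENNReal.ofReal p)).restrict Q
  obtain ⟨e, a, hrep, hcost⟩ := (h.induced hQ).exists_souza_representation_of_mem_bvAtoms
    (h.inducedGrid_zero hQ) hp hβ hββ' hβp hq hgeom hscaled
    (z * ((m.real Q ^ (s - β) : ℝ) : ℂ))
  have hcancel : (fun x => z * ((m.real Q ^ (s - β) : ℝ) : ℂ) *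
      ((((m.restrict Q).real Q ^ (β - s) : ℝ) : ℂ) * b x)) = fun x => z * b x := by
    funext x
    rw [hrestrict, mul_assoc, ← mul_assoc (Complex.ofReal _), ← Complex.ofReal_mul,
      ← Real.rpow_add hpos]
    simp
  rw [hcancel] at hrep
  refine ⟨fun x hx => by simp [hb.1 x hx], k, hQ, ⟨hbLp.const_mul z, e, a, hrep⟩, ?_⟩
  refine (besovNorm_le_cost hrep).trans (hcost.trans ?_)
  rw [ofReal_real_rpow (h.pos k Q hQ), enorm_mul, enorm_ofReal_real_rpow (h.pos k Q hQ),
    ← mul_assoc, mul_right_comm]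
  gcongr

end IsIntervalGrid

end SingleAtoms

section Comparison

section

variable {Ω : Type*} {P : ℕ → Finset (Set Ω)} {p : ℝ} {q : ℝ≥0∞}

theorem besovAtomConst_le {c₂ β : ℝ} (hc₂ : 0 ≤ c₂) (hq : 1 ≤ q) :
    besovAtomConst P c₂ β p q ≤
      gridMult P ^ (1 + 1 / p) * (1 - ENNReal.ofReal (c₂ ^ β))⁻¹ := by
  rw [besovAtomConst_eq_eLpNorm hc₂ (one_pos.trans_le hq).ne']
  gcongr
  exact eLpNorm_geometric_le hq _

theorem exists_besovAtomConst_le {c₂ β : ℝ} (hc₂ : 0 ≤ c₂) (hc₂' : c₂ < 1) (hβ : 0 < β)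
    (hp : 0 ≤ p) (hmult : gridMult P ≠ ∞) :
    ∃ K ≠ ∞, ∀ q, 1 ≤ q → besovAtomConst P c₂ β p q ≤ K := by
  refine ⟨_, ENNReal.mul_ne_top (ENNReal.rpow_ne_top_of_nonneg (by positivity) hmult)
    (ENNReal.inv_ne_top.2 (tsub_pos_of_lt ?_).ne'), fun q hq => besovAtomConst_le hc₂ hq⟩
  exact ENNReal.ofReal_lt_one.2 (Real.rpow_lt_one hc₂ hc₂' hβ)

variable [MeasurableSpace Ω] {m : Measure Ω} {A B : Set Ω → Set (Ω → ℂ)}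

theorem IsRepresentation.mono (hAB : ∀ Q, A Q ⊆ B Q) {g : Ω → ℂ} {c : Set Ω → ℂ}
    {a : Set Ω → Ω → ℂ} (h : IsRepresentation m P A p q g c a) :
    IsRepresentation m P B p q g c a :=
  { h with atom := fun k Q hQ => hAB Q (h.atom k Q hQ) }

theorem besovSpace_mono (hAB : ∀ Q, A Q ⊆ B Q) : besovSpace m P A p q ⊆ besovSpace m P B p q :=
  fun _ ⟨hg, c, a, hrep⟩ => ⟨hg, c, a, hrep.mono hAB⟩

theorem besovNorm_anti (hAB : ∀ Q, A Q ⊆ B Q) (g : Ω → ℂ) :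
    besovNorm m P B p q g ≤ besovNorm m P A p q g :=
  le_iInf fun _ => le_iInf₂ fun _ hrep => besovNorm_le_cost (hrep.mono hAB)

theorem besovNorm_le_mul {D : ℝ≥0∞} (hD₀ : D ≠ 0) (hD : D ≠ ∞) {g : Ω → ℂ}
    (h : ∀ c a, IsRepresentation m P A p q g c a →
      ∃ e b, IsRepresentation m P B p q g e b ∧ cost p q P e ≤ D * cost p q P c) :
    besovNorm m P B p q g ≤ D * besovNorm m P A p q g := by
  simp only [besovNorm, ENNReal.mul_iInf_of_ne hD₀ hD]
  refine le_iInf fun c => le_iInf₂ fun a hrep => ?_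
  obtain ⟨e, b, hrep', hcost⟩ := h c a hrep
  exact (besovNorm_le_cost hrep').trans hcost

theorem IsGoodGrid.isRefiningGrid [IsFiniteMeasure m] {I : Set Ω} {c₁ c₂ : ℝ}
    (h : IsGoodGrid m I P c₁ c₂) (hI : m Iᶜ = 0) :
    IsRefiningGrid m P (ENNReal.ofReal c₁) (ENNReal.ofReal c₂) := by
  have hpos {k : ℕ} {R : Set Ω} (hR : R ∈ P k) : 0 < m.real R :=
    ENNReal.toReal_pos (h.pos k R hR).ne' (measure_ne_top m R)
  exact
  { κ_ne_zero := by simpa using h.c₁_pos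
    θ_lt_one := by simpa using h.c₂_lt
    measurable := h.measurable
    pos := h.pos
    cover := fun k => by
      filter_upwards [mem_ae_iff.2 hI, measure_eq_zero_iff_ae_notMem.1 (h.cover k)]
        with x hxI hx
      by_contra hx'
      exact hx ⟨hxI, by simpa using hx'⟩
    disjoint := h.disjoint
    nested := h.nested
    lower := fun k R hR Q hQ hQR => by
      rw [← ofReal_measureReal (s := R), ← ofReal_measureReal (s := Q),
        ← ENNReal.ofReal_mul h.c₁_pos.le]
      exact ENNReal.ofReal_le_ofReal ((le_div_iff₀ (hpos hR)).1 (h.ratio k R hR Q hQ hQR).1)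
    upper := fun k R hR Q hQ hQR => by
      rw [← ofReal_measureReal (s := R), ← ofReal_measureReal (s := Q),
        ← ENNReal.ofReal_mul (h.c₁_pos.trans h.c₁_lt).le]
      exact ENNReal.ofReal_le_ofReal ((div_le_iff₀ (hpos hR)).1 (h.ratio k R hR Q hQ hQR).2) }

end

theorem exists_pos_mul_enorm_le_inv {X K : ℝ≥0∞} (hX : X ≠ ∞) (hK : K ≠ ∞) :
    ∃ C : ℝ, 0 < C ∧ X * ‖(C : ℂ)‖ₑ ≤ K⁻¹ := by
  obtain ⟨C, hC, hle⟩ := ENNReal.exists_nnreal_pos_mul_lt (ENNReal.mul_ne_top hX hK) one_ne_zero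
  refine ⟨C, hC, ENNReal.le_inv_iff_mul_le.2 (le_trans (le_of_eq ?_) hle.le)⟩
  have henorm : ‖((C : ℝ) : ℂ)‖ₑ = C := by simp [← ofReal_norm]
  rw [henorm]
  ring

namespace IsIntervalGrid

variable {m : Measure ℝ} [IsFiniteMeasure m] {P : ℕ → Finset (Set ℝ)} {κ θ : ℝ≥0∞} {p s β : ℝ}

theorem exists_const_mul_mem_besovAtoms (h : IsIntervalGrid m P κ θ) (hmult : gridMult P ≠ ∞)
    {c₂ β' : ℝ} (hc₂ : 0 ≤ c₂) (hc₂' : c₂ < 1) (hp : 1 ≤ p) (hβ : 0 < β) (hββ' : β ≤ β')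
    (hβp : β' ≤ 1 / p) {E : ℝ≥0∞} (hE : E ≠ ∞) :
    ∃ C : ℝ, 0 < C ∧ ∀ q : ℝ≥0∞, 1 ≤ q →
      eLpNorm (fun k => (θ ^ (β' - β)) ^ k) q Measure.count ≤ E →
      ∀ k, ∀ Q ∈ P k, ∀ b ∈ bvAtoms m s β' p Q,
        (fun x => (C : ℂ) * b x) ∈ besovAtoms m P c₂ s β p q Q := by
  have hp₀ : 0 ≤ p := by linarith
  obtain ⟨K, hK, hconst⟩ := exists_besovAtomConst_le hc₂ hc₂' hβ hp₀ hmult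
  obtain ⟨C, hC, hle⟩ :=
    exists_pos_mul_enorm_le_inv
      (ENNReal.mul_ne_top (h.two_add_inv_rpow_ne_top (one_div_nonneg.2 hp₀)) hE) hK
  refine ⟨C, hC, fun q hq hgeom k Q hQ b hb => h.mem_besovAtoms hp hβ hββ' hβp
    (one_pos.trans_le hq).ne' (ne_top_of_le_ne_top hE hgeom) ?_ hQ hb⟩
  calc (2 + κ⁻¹ ^ (1 / p)) * ‖(C : ℂ)‖ₑ *
        eLpNorm (fun k => (θ ^ (β' - β)) ^ k) q Measure.count
      ≤ (2 + κ⁻¹ ^ (1 / p)) * ‖(C : ℂ)‖ₑ * E := by gcongr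
    _ ≤ K⁻¹ := by rwa [mul_right_comm]
    _ ≤ (besovAtomConst P c₂ β p q)⁻¹ := ENNReal.inv_le_inv.2 (hconst q hq)

theorem exists_souza_representation (h : IsIntervalGrid m P κ θ) (hp : 1 ≤ p) (hs : 0 < s)
    (hsβ : s < β) (hβp : β ≤ 1 / p) :
    ∃ D ≠ 0, D ≠ ∞ ∧ ∀ q : ℝ≥0∞, 1 ≤ q → ∀ g, AEStronglyMeasurable g m → ∀ c a,
      IsRepresentation m P (bvAtoms m s β p) p q g c a →
      ∃ e b, IsRepresentation m P (souzaAtoms m s p) p q g e b ∧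
        cost p q P e ≤ D * cost p q P c := by
  have hβ : 0 < β := hs.trans hsβ
  have hρ : θ ^ (β - s) < 1 := ENNReal.rpow_lt_one h.θ_lt_one (sub_pos.2 hsβ)
  have hD : (2 + κ⁻¹ ^ (1 / p)) * (1 - θ ^ (β - s))⁻¹ ≠ ∞ :=
    ENNReal.mul_ne_top (h.two_add_inv_rpow_ne_top (by positivity))
      (ENNReal.inv_ne_top.2 (tsub_pos_of_lt hρ).ne')
  refine ⟨_, mul_ne_zero (by simp) (ENNReal.inv_ne_zero.2 (ENNReal.sub_ne_top ENNReal.one_ne_top)),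
    hD, fun q hq g hg c a hrep => ?_⟩
  have hcost := cost_le_of_levelCost_le_convolution hq
    (h.levelCost_souzaCoeff_le hp hβ hsβ.le hβp hrep.atom (c := c))
  exact ⟨_, _, h.isRepresentation_souza hp hs hsβ.le hβp (one_pos.trans_le hq).ne' hg hrep
    (hcost.trans_lt (ENNReal.mul_lt_top hD.lt_top hrep.cost_lt)), hcost⟩

end IsIntervalGrid

end Comparison

end BesovGrid

end

open BesovGrid in
theorem proposition14p3_general (m : Measure ℝ) [IsFiniteMeasure m] (I : Set ℝ) (hm : m Iᶜ = 0)
    (P : ℕ → Finset (Set ℝ)) (c₁ c₂ : ℝ) (hP : IsGoodGrid m I P c₁ c₂)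
    (hint : ∀ k, ∀ Q ∈ P k, Q.OrdConnected) (p : ℝ) (hp : 1 ≤ p) :
    (∀ s β : ℝ, 0 < β → β ≤ 1 / p →
      ∃ C : ℝ, 0 < C ∧ ∀ k, ∀ Q ∈ P k, ∀ a ∈ bvAtoms m s β p Q,
        (fun x => (C : ℂ) * a x) ∈ besovAtoms m P c₂ s β p ∞ Q) ∧
    (∀ s β β' : ℝ, 0 < β → β < β' → β' ≤ 1 / p →
      ∃ C : ℝ, 0 < C ∧ ∀ q : ℝ≥0∞, 1 ≤ q → ∀ k, ∀ Q ∈ P k, ∀ a ∈ bvAtoms m s β' p Q,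
        (fun x => (C : ℂ) * a x) ∈ besovAtoms m P c₂ s β p q Q) ∧
    (∀ s β : ℝ, 0 < s → s < β → β ≤ 1 / p → ∀ q : ℝ≥0∞, 1 ≤ q →
      besovSpace m P (souzaAtoms m s p) p q = besovSpace m P (bvAtoms m s β p) p q ∧
      ∃ C₁ C₂ : ℝ, 0 < C₁ ∧ 0 < C₂ ∧ ∀ f ∈ besovSpace m P (souzaAtoms m s p) p q,
        besovNorm m P (bvAtoms m s β p) p q f ≤
          ENNReal.ofReal C₁ * besovNorm m P (souzaAtoms m s p) p q f ∧
        besovNorm m P (souzaAtoms m s p) p q f ≤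
          ENNReal.ofReal C₂ * besovNorm m P (bvAtoms m s β p) p q f) := by
  have h : IsIntervalGrid m P (ENNReal.ofReal c₁) (ENNReal.ofReal c₂) :=
    ⟨hP.isRefiningGrid hm, hint⟩
  have hc₂ : 0 ≤ c₂ := (hP.c₁_pos.trans hP.c₁_lt).le
  refine ⟨fun s β hβ hβp => ?_, fun s β β' hβ hββ' hβp => ?_,
    fun s β hs hsβ hβp q hq => ?_⟩
  · obtain ⟨C, hC, hmem⟩ := h.exists_const_mul_mem_besovAtoms hP.mult.ne hc₂ hP.c₂_lt hp
      hβ le_rfl hβp ENNReal.one_ne_top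
    exact ⟨C, hC, hmem ∞ le_top (eLpNorm_top_geometric_le_one (by simp))⟩
  · have hρ := ENNReal.rpow_lt_one h.θ_lt_one (sub_pos.2 hββ')
    obtain ⟨C, hC, hmem⟩ := h.exists_const_mul_mem_besovAtoms hP.mult.ne hc₂ hP.c₂_lt hp
      hβ hββ'.le hβp (ENNReal.inv_ne_top.2 (tsub_pos_of_lt hρ).ne')
    exact ⟨C, hC, fun q hq => hmem q hq (eLpNorm_geometric_le hq _)⟩
  · obtain ⟨D, hD₀, hD, hsouza⟩ := h.exists_souza_representation hp hs hsβ hβp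
    have hmono := souzaAtoms_subset_bvAtoms (m := m) (s := s) (p := p) (hs.trans hsβ)
    refine ⟨(besovSpace_mono hmono).antisymm fun g ⟨hg, c, a, hrep⟩ => ?_,
      1, D.toReal, one_pos, ENNReal.toReal_pos hD₀ hD, fun f hf => ⟨?_, ?_⟩⟩
    · obtain ⟨e, b, hrep', -⟩ := hsouza q hq g hg.1 c a hrep
      exact ⟨hg, e, b, hrep'⟩
    · simpa using besovNorm_anti hmono f
    · rw [ENNReal.ofReal_toReal hD]
      exact besovNorm_le_mul hD₀ hD (hsouza q hq f hf.1.1)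

open BesovGrid in
theorem proposition14p3 (I : Set ℝ) (hI : I.OrdConnected) (hI1 : volume I = 1)
    (m : Measure ℝ) (hm : m = volume.restrict I)
    (P : ℕ → Finset (Set ℝ)) (c₁ c₂ : ℝ) (hP : IsGoodGrid m I P c₁ c₂)
    (hint : ∀ k, ∀ Q ∈ P k, Q.OrdConnected) (p : ℝ) (hp : 1 ≤ p) :
    (∀ s β : ℝ, 0 < s → s ≤ β → β ≤ 1 / p →
      ∃ C : ℝ, 0 < C ∧ ∀ k, ∀ Q ∈ P k, ∀ a ∈ bvAtoms m s β p Q,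
        (fun x => (C : ℂ) * a x) ∈ besovAtoms m P c₂ s β p ∞ Q) ∧
    (∀ s β β' : ℝ, 0 < s → s ≤ β → β < β' → β' ≤ 1 / p →
      ∃ C : ℝ, 0 < C ∧ ∀ q : ℝ≥0∞, 1 ≤ q → ∀ k, ∀ Q ∈ P k, ∀ a ∈ bvAtoms m s β' p Q,
        (fun x => (C : ℂ) * a x) ∈ besovAtoms m P c₂ s β p q Q) ∧
    (∀ s β : ℝ, 0 < s → s < β → β ≤ 1 / p → ∀ q : ℝ≥0∞, 1 ≤ q →
      besovSpace m P (souzaAtoms m s p) p q = besovSpace m P (bvAtoms m s β p) p q ∧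
      ∃ C₁ C₂ : ℝ, 0 < C₁ ∧ 0 < C₂ ∧ ∀ f ∈ besovSpace m P (souzaAtoms m s p) p q,
        besovNorm m P (bvAtoms m s β p) p q f ≤
          ENNReal.ofReal C₁ * besovNorm m P (souzaAtoms m s p) p q f ∧
        besovNorm m P (souzaAtoms m s p) p q f ≤
          ENNReal.ofReal C₂ * besovNorm m P (bvAtoms m s β p) p q f) := by
  subst hm
  have : IsFiniteMeasure (volume.restrict I) := ⟨by simp [hI1]⟩
  obtain ⟨hcritical, hsubcritical, hspaces⟩ := proposition14p3_general (volume.restrict I) I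
    (mem_ae_iff.1 (ae_restrict_mem hI.measurableSet)) P c₁ c₂ hP hint p hp
  exact ⟨fun s β hs hsβ => hcritical s β (hs.trans_le hsβ),
    fun s β β' hs hsβ => hsubcritical s β β' (hs.trans_le hsβ), hspaces⟩
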